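/- For $v\in\mathbb R^2=\mathbb C$ let $\tau_v$ be the translation $x\mapsto x+v$ and for $\theta\in\mathbb R$ let $\rho_\theta$ be the rotation $x\mapsto e^{i\theta}x$ of the plane. Let $\theta\in\mathbb R$ with $\cos\theta\in\mathbb Q\setminus\frac12\mathbb Z$, and let $\mu$ be a probability measure on $\mathrm{Isom}(\mathbb R^2)$ of one of the following two kinds: 1. (Littlewood polynomials) $\mu$ is the uniform distribution on $\{\tau_1\rho_\theta,\tau_{-1}\rho_\theta\}$; 2. (asymmetric wreath product) $\operatorname{supp}\mu=\{\rho_\theta,\rho_{-\theta},\tau_1,\tau_{-1}\}$ with $\mu(\{\tau_1\})=\mu(\{\tau_{-1}\})$ and $\mu(\{\rho_\theta\})\neq\mu(\{\rho_{-\theta}\})$. Let $g_1,g_2,\dots$ be independent random isometries with law $\mu$, let $Y_N:=(g_1g_2\cdots g_N)(0)$, and let $\sigma\ge 0$ be given by $\sigma^2:=\frac12\mathbf E|g_1(0)|^2$. Then there are constants $c>0$ and $C>0$, depending only on $\mu$, such that for every integer $N\ge 2$, every $x_0\in\mathbb R^2$ and every $r>\exp(-c\sqrt N/\log N)$, $$\bigl|\mathbb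 P(Y_N\in B_r(x_0))-\mathbb P(\sigma\sqrt N\,Z_1\in B_r(x_0))\bigr|\le C N^{-3/2}r^2,$$ where $Z_1$ is the standard Gaussian on $\mathbb R^2$ and $B_r(x_0)$ is the open disc of radius $r$ about $x_0$. -/

import Mathlib

open MeasureTheory ProbabilityTheory

namespace PlanarWalk

noncomputable section

/-- The Borel σ-algebra of the isometry group of the plane `ℂ = ℝ²`: the one generated by the
evaluation maps `g ↦ g x`. -/
instance instMeasurableSpaceIsom : MeasurableSpace (ℂ ≃ᵢ ℂ) :=
  MeasurableSpace.comap (fun (g : ℂ ≃ᵢ ℂ) (x : ℂ) => g x) MeasurableSpace.pi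

/-- The translation `x ↦ x + v` of the plane. -/
def τ (v : ℂ) : ℂ ≃ᵢ ℂ := IsometryEquiv.addRight v

/-- The rotation `x ↦ e^{iθ} x` of the plane. -/
def ρ (θ : ℝ) : ℂ ≃ᵢ ℂ := (rotation (Circle.exp θ)).toIsometryEquiv

/-- The Littlewood polynomial measure: `μ` is uniformly distributed on the two (distinct)
isometries `τ₁ ∘ ρ_θ` and `τ₋₁ ∘ ρ_θ`. -/
def IsLittlewood (θ : ℝ) (μ : PMF (ℂ ≃ᵢ ℂ)) : Prop :=
  μ (τ 1 * ρ θ) = 2⁻¹ ∧ μ (τ (-1) * ρ θ) = 2⁻¹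

/-- `μ` generates an asymmetric wreath product. -/
structure IsAsymmetricWreath (θ : ℝ) (μ : PMF (ℂ ≃ᵢ ℂ)) : Prop where
  support_eq : μ.support = {ρ θ, ρ (-θ), τ 1, τ (-1)}
  translation_eq : μ (τ 1) = μ (τ (-1))
  rotation_ne : μ (ρ θ) ≠ μ (ρ (-θ))

/-- `g 0, g 1, …` are independent random isometries, each with law `μ`. -/
structure IsIIDSample {Ω : Type*} [MeasurableSpace Ω] (P : Measure Ω) (g : ℕ → Ω → (ℂ ≃ᵢ ℂ))
    (μ : PMF (ℂ ≃ᵢ ℂ)) : Prop where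
  hasLaw : ∀ j, HasLaw (g j) μ.toMeasure P
  indep : iIndepFun g P

/-- The random walk `Y_N = (g₁ g₂ ⋯ g_N)(0)`; the factor `g_j` is `g (j - 1)` here, and the
product in the group `ℂ ≃ᵢ ℂ` is composition. -/
def walk {Ω : Type*} (g : ℕ → Ω → (ℂ ≃ᵢ ℂ)) (N : ℕ) (ω : Ω) : ℂ :=
  (List.ofFn fun j : Fin N => g j ω).prod 0

/-- The number `σ ≥ 0` with `σ² = ½ 𝔼 |g(0)|²`, where `g` has law `μ`. -/
def stdDev (μ : PMF (ℂ ≃ᵢ ℂ)) : ℝ :=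
  √(1 / 2 * ∫ g, ‖g 0‖ ^ 2 ∂μ.toMeasure)

end

end PlanarWalk

namespace PlanarWalk

/-! Compare characteristic functions and invert the Fourier transform. Conditioning on the outermost
factor `g 0` gives a linear recursion: one step is the operator `StepWeights.transfer`, which mixes
rotations of the frequency `ξ` and damps some terms by `cos ξ.re`. Both kinds of `μ` fit this form,
with a net drift in one direction of rotation (after exchanging `θ` and `-θ` if necessary).

High frequencies use the arithmetic of `θ`. Write `2 cos θ = a / b` in lowest terms; `b ≥ 2` because
`cos θ` is not a half-integer. The numbers `Re (u ^ j ξ) / π` satisfy `b x_{j+2} - a x_{j+1} + b x_j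
= 0`. If they all stay near integers for about `2 log₂ ‖ξ‖` steps, those integers satisfy the
recurrence exactly, so high powers of `b` divide the middle ones, which are too small and must
vanish. Then `ξ` itself is small, a contradiction (`exists_abs_cos_le`). Hence the cosine damps
after `O(log ‖ξ‖)` rotations. The drift turns this into a decay rate of order `1 / log ‖ξ‖` by means
of a Lyapunov function (`abs_char_le_of_gap`). Trading `n / log ‖ξ‖` against `log ‖ξ‖` by AM-GM
gives `exp (-c √n)` up to a factor linear in `‖ξ‖` (`exists_abs_char_le`).

At low frequencies a quadratic corrector cancels the anisotropic part of the cosine's second-order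
term, leaving an error of order `‖ξ‖ ^ 4` per step. After `n` steps the characteristic function is
Gaussian up to `O(1 / n)` times a Gaussian (`exists_abs_char_sub_exp_le`), and integrating over the
plane gains another factor `1 / n`.

Finally, convolve both laws with a Gaussian much narrower than `r`, so that inversion bounds the
difference of densities by `O(N ^ (-2))`, and remove the smoothing at the same cost
(`abs_ball_sub_ball_le`). This yields the stronger error `C r ^ 2 / N ^ 2` for all `r > exp (-c √N)`
(`exists_local_limit`). -/

theorem mul_exp_neg_le {a x : ℝ} (ha : 0 < a) : x * Real.exp (-(a * x)) ≤ 1 / a := by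
  have h1 := Real.add_one_le_exp (a * x)
  have h2 : a * x * Real.exp (-(a * x)) ≤ 1 := by
    calc _ ≤ Real.exp (a * x) * Real.exp (-(a * x)) := by gcongr; linarith
      _ = 1 := by rw [← Real.exp_add]; simp
  rw [le_div_iff₀ ha]; linarith

/-! ### Arithmetic of rotations with rational cosine -/

/-- If `b ^ k` divides both neighbours of an entry, the recurrence gives `b ^ (k + 1) ∣ a * n (i +
1)`, and `a` is coprime to `b`. Each extra power costs one index at either end. -/
theorem pow_dvd_of_recurrence {a b : ℤ} (hab : IsCoprime a b) {n : ℕ → ℤ} {L : ℕ}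
    (h : ∀ j, j + 2 ≤ L → b * n (j + 2) - a * n (j + 1) + b * n j = 0) (k : ℕ) :
    ∀ j, k ≤ j → j + k ≤ L → b ^ k ∣ n j := by
  induction k with
  | zero => simp
  | succ k ih =>
    intro j hj hL
    obtain ⟨i, rfl⟩ : ∃ i, j = i + 1 := ⟨j - 1, by omega⟩
    obtain ⟨x, hx⟩ := ih (i + 2) (by omega) (by omega)
    obtain ⟨y, hy⟩ := ih i (by omega) (by omega)
    have h1 := h i (by omega)
    have : b ^ (k + 1) ∣ a * n (i + 1) := ⟨x + y, by rw [hx, hy] at h1; linear_combination -h1⟩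
    exact (hab.symm.pow_left).dvd_of_dvd_mul_left this

/-- `|cos|` has period `π`, so `x` may be replaced by its offset `y` from the nearest multiple of
`π`, where `cos y ≤ 1 - 2 y ^ 2 / π ^ 2`. -/
theorem abs_cos_le_of_dist_int {ε x : ℝ} (hε : 0 ≤ ε) (h : ε ≤ |x / Real.pi - round (x / Real.pi)|) :
    |Real.cos x| ≤ 1 - 2 * ε ^ 2 := by
  have hpi := Real.pi_pos
  set n := round (x / Real.pi)
  set y := x - n * Real.pi
  have hy : y = (x / Real.pi - n) * Real.pi := by simp only [y]; field_simp
  have h2 : |x / Real.pi - n| ≤ 1 / 2 := abs_sub_round _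
  have hya : |y| = |x / Real.pi - n| * Real.pi := by rw [hy, abs_mul, abs_of_pos hpi]
  have hy2 : |y| ≤ Real.pi / 2 := by rw [hya]; nlinarith
  have hc : |Real.cos x| = |Real.cos y| := by
    simp only [y]
    rw [Real.cos_sub_int_mul_pi, abs_mul, abs_zpow]
    simp
  have hq := Real.cos_le_one_sub_mul_cos_sq (x := y) (by linarith)
  have hn : 0 ≤ Real.cos y := Real.cos_nonneg_of_mem_Icc (by rw [abs_le] at hy2; exact ⟨by linarith, by linarith⟩)
  rw [hc, abs_of_nonneg hn]
  refine hq.trans ?_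
  have : 2 / Real.pi ^ 2 * y ^ 2 = 2 * |x / Real.pi - n| ^ 2 := by
    rw [hy, sq_abs]; field_simp
  rw [this]
  gcongr

/-- A rotation by an angle with rational, non-half-integral cosine moves every vector of the
plane, within a number of steps logarithmic in its length, to one whose real part stays away
from `πℤ`. -/
theorem exists_abs_cos_le {θ : ℝ} (hrat : ∃ q : ℚ, Real.cos θ = q)
    (hhalf : ¬ ∃ k : ℤ, Real.cos θ = k / 2) {κ : ℝ} (hκ : 0 < κ) :
    ∃ δ : ℝ, 0 < δ ∧ δ ≤ 1 ∧ ∀ ξ : ℂ, κ ≤ ‖ξ‖ → ∀ k : ℕ, ‖ξ‖ + 1 < 2 ^ k →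
      ∃ j ≤ 2 * k + 1, |Real.cos ((Complex.exp (θ * Complex.I) ^ j * ξ).re)| ≤ 1 - δ := by
  obtain ⟨q, hq⟩ := hrat
  set a : ℤ := (2 * q).num with ha
  set b : ℤ := ((2 * q).den : ℤ) with hb
  have hbpos : 0 < (2 * q).den := (2 * q).den_pos
  have hcos : 2 * Real.cos θ * b = a := by
    have : (2 * q) * ((2 * q).den : ℚ) = (2 * q).num := Rat.mul_den_eq_num _
    rw [hq]; exact_mod_cast this
  have hb2 : 2 ≤ b := by
    by_contra hlt
    have h1 : b = 1 := by omega
    rw [h1] at hcos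
    exact hhalf ⟨a, by push_cast at hcos; linarith⟩
  have hab : IsCoprime a b := by
    rw [Int.isCoprime_iff_gcd_eq_one]
    have := (2 * q).reduced
    simpa [Int.gcd, ha, hb] using this
  have hbR : (2 : ℝ) ≤ b := by exact_mod_cast hb2
  have habs : |(a : ℝ)| ≤ 2 * b := by
    rw [← hcos, abs_mul, abs_mul, abs_of_pos (by linarith : (0 : ℝ) < b)]
    have := Real.abs_cos_le_one θ
    norm_num
    nlinarith
  have hsin : 0 < |Real.sin θ| := by
    rw [abs_pos]
    intro h0
    have h1 := Real.sin_sq_add_cos_sq θ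
    rw [h0] at h1
    have h2 : (Real.cos θ - 1) * (Real.cos θ + 1) = 0 := by linarith
    rcases mul_eq_zero.1 h2 with h | h
    · exact hhalf ⟨2, by push_cast; linarith⟩
    · exact hhalf ⟨-2, by push_cast; linarith⟩
  set S := |Real.sin θ| with hS
  have hS1 : S ≤ 1 := Real.abs_sin_le_one θ
  have hpi := Real.pi_pos
  have hpi4 := Real.pi_le_four
  -- `4 b ε < 1` makes the rounded recurrence exact, since its error is at most `(b + 2 b + b) ε`.
  -- `12 ε < κ S` contradicts the final bound `S ‖ξ‖ ≤ 4 ε + 8 ε`.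
  obtain ⟨ε, hε, hε1, hε2⟩ : ∃ ε : ℝ, 0 < ε ∧ 4 * b * ε < 1 ∧ 12 * ε < κ * S := by
    refine ⟨min (1 / (8 * (b : ℝ))) (κ * S / 24), by positivity, ?_, ?_⟩
    · calc 4 * (b : ℝ) * min (1 / (8 * (b : ℝ))) (κ * S / 24) ≤ 4 * b * (1 / (8 * b)) := by
            gcongr; exact min_le_left _ _
        _ < 1 := by field_simp; norm_num
    · calc 12 * min (1 / (8 * (b : ℝ))) (κ * S / 24) ≤ 12 * (κ * S / 24) := by
            gcongr; exact min_le_right _ _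
        _ < κ * S := by nlinarith [mul_pos hκ hsin]
  refine ⟨2 * ε ^ 2, by positivity, by nlinarith, ?_⟩
  intro ξ hξ k hk
  by_contra! hcon
  set u := Complex.exp (θ * Complex.I) with hu
  have hunorm : ‖u‖ = 1 := by rw [hu]; exact Complex.norm_exp_ofReal_mul_I θ
  have hure : u.re = Real.cos θ := by rw [hu]; exact Complex.exp_ofReal_mul_I_re θ
  have huim : u.im = Real.sin θ := by rw [hu]; exact Complex.exp_ofReal_mul_I_im θ
  set x : ℕ → ℝ := fun j => (u ^ j * ξ).re / Real.pi with hx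
  set n : ℕ → ℤ := fun j => round (x j) with hn
  have hxn : ∀ j ≤ 2 * k + 1, |x j - n j| < ε := by
    intro j hj
    by_contra! h
    exact absurd (abs_cos_le_of_dist_int hε.le h) (not_le.2 (hcon j hj))
  have hrec : ∀ j, b * x (j + 2) - a * x (j + 1) + b * x j = 0 := by
    intro j
    have hu2 : u ^ 2 = ((2 * Real.cos θ : ℝ) : ℂ) * u - 1 := by
      apply Complex.ext
      · rw [Complex.sub_re, Complex.re_ofReal_mul, pow_two, Complex.mul_re, hure, huim,
          Complex.one_re]
        nlinarith [Real.sin_sq_add_cos_sq θ]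
      · rw [Complex.sub_im, Complex.im_ofReal_mul, pow_two, Complex.mul_im, hure, huim,
          Complex.one_im]
        ring
    have h1 : u ^ (j + 2) * ξ = ((2 * Real.cos θ : ℝ) : ℂ) * (u ^ (j + 1) * ξ) - u ^ j * ξ := by
      rw [pow_add, hu2, pow_succ]; ring
    have h2 : (u ^ (j + 2) * ξ).re
        = 2 * Real.cos θ * (u ^ (j + 1) * ξ).re - (u ^ j * ξ).re := by
      rw [h1, Complex.sub_re, Complex.re_ofReal_mul]
    simp only [hx]
    rw [h2, ← hcos]
    ring
  have hnrec : ∀ j, j + 2 ≤ 2 * k + 1 → b * n (j + 2) - a * n (j + 1) + b * n j = 0 := by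
    intro j hj
    have e0 := hxn j (by omega)
    have e1 := hxn (j + 1) (by omega)
    have e2 := hxn (j + 2) (by omega)
    have key : |((b * n (j + 2) - a * n (j + 1) + b * n j : ℤ) : ℝ)| < 1 := by
      have heq : ((b * n (j + 2) - a * n (j + 1) + b * n j : ℤ) : ℝ)
          = -(b * (x (j + 2) - n (j + 2))) + a * (x (j + 1) - n (j + 1))
            - b * (x j - n j) := by
        push_cast; linear_combination hrec j
      rw [heq]
      have hb0 : (0 : ℝ) < b := by linarith
      have t0 : |b * (x j - n j)| ≤ b * ε := by
        rw [abs_mul, abs_of_pos hb0]; gcongr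
      have t2 : |b * (x (j + 2) - n (j + 2))| ≤ b * ε := by
        rw [abs_mul, abs_of_pos hb0]; gcongr
      have t1 : |a * (x (j + 1) - n (j + 1))| ≤ 2 * b * ε := by
        rw [abs_mul]; gcongr
      rw [abs_le] at t0 t1 t2
      rw [abs_lt]
      constructor <;> linarith
    rw [← Int.cast_abs] at key
    exact Int.abs_lt_one_iff.1 (by exact_mod_cast key)
  have hxle : ∀ j, |x j| ≤ ‖ξ‖ / Real.pi := by
    intro j
    simp only [hx]
    rw [abs_div, abs_of_pos hpi]
    gcongr
    refine (Complex.abs_re_le_norm _).trans ?_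
    simp [hunorm]
  -- The window consists of the two indices `k` and `k + 1`; two consecutive real parts are what it
  -- takes to control `ξ`, as `u` is not real.
  have hzero : ∀ j, k ≤ j → j + k ≤ 2 * k + 1 → n j = 0 := by
    intro j h1 h2
    refine Int.eq_zero_of_abs_lt_dvd (pow_dvd_of_recurrence hab hnrec k j h1 h2) ?_
    have h3 : |(n j : ℝ)| < ((b : ℝ)) ^ k := by
      have h4 := hxn j (by omega)
      have h5 : |(n j : ℝ)| ≤ |x j| + ε := by
        have := abs_sub_abs_le_abs_sub (n j : ℝ) (x j)
        rw [abs_sub_comm] at this; linarith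
      have h6 : ‖ξ‖ / Real.pi ≤ ‖ξ‖ := by
        rw [div_le_iff₀ hpi]; nlinarith [norm_nonneg ξ, Real.pi_gt_three]
      have h7 : (2 : ℝ) ^ k ≤ (b : ℝ) ^ k := by gcongr
      have := hxle j
      nlinarith
    exact_mod_cast h3
  have hre : ∀ j, k ≤ j → j + k ≤ 2 * k + 1 → |(u ^ j * ξ).re| ≤ 4 * ε := by
    intro j h1 h2
    have h3 := hxn j (by omega)
    rw [hzero j h1 h2] at h3
    simp only [hx, Int.cast_zero, sub_zero, abs_div, abs_of_pos hpi] at h3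
    rw [div_lt_iff₀ hpi] at h3
    nlinarith
  set η := u ^ k * ξ with hη
  have h0 : |η.re| ≤ 4 * ε := hre k le_rfl (by omega)
  have h1 : |(u * η).re| ≤ 4 * ε := by
    have := hre (k + 1) (by omega) (by omega)
    rwa [pow_succ', mul_assoc] at this
  have hηn : ‖η‖ = ‖ξ‖ := by simp [hη, hunorm]
  rw [Complex.mul_re, hure, huim] at h1
  have h2 : S * |η.im| ≤ 8 * ε := by
    rw [hS, ← abs_mul]
    have h3 : |Real.cos θ * η.re| ≤ 4 * ε := by
      rw [abs_mul]
      calc _ ≤ 1 * |η.re| := by gcongr; exact Real.abs_cos_le_one θ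
        _ ≤ _ := by linarith
    rw [abs_le] at h1 h3 ⊢
    constructor <;> linarith
  have h4 := Complex.norm_le_abs_re_add_abs_im η
  rw [hηn] at h4
  nlinarith [abs_nonneg η.re, abs_nonneg η.im, mul_le_mul_of_nonneg_right (hξ.trans h4) hsin.le]
-- The transfer operator and its characteristic functions
open ComplexConjugate

/-- The probabilities of the steps of a random walk on rotations by powers of `u`: a rotation by
`u`, the same rotation followed by a symmetric random translation by `±1`, the inverse rotation,
and a symmetric random translation. The walk drifts in the direction of `u`. -/
structure StepWeights where
  rot : ℝ
  rotFlip : ℝ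
  back : ℝ
  flip : ℝ
  rot_nonneg : 0 ≤ rot
  rotFlip_nonneg : 0 ≤ rotFlip
  back_nonneg : 0 ≤ back
  flip_nonneg : 0 ≤ flip
  sum_eq_one : rot + rotFlip + back + flip = 1
  drift : back < rot + rotFlip
  flip_pos : 0 < rotFlip + flip

namespace StepWeights

variable (W : StepWeights) (u : ℂ)

/-- The operator that expresses the characteristic function of the walk after `n + 1` steps in
terms of the one after `n` steps. -/
noncomputable def transfer (F : ℂ → ℝ) (ξ : ℂ) : ℝ :=
  (W.rot + W.rotFlip * Real.cos ξ.re) * F (u * ξ) + W.back * F (conj u * ξ)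
    + W.flip * Real.cos ξ.re * F ξ

/-- The characteristic function of the walk after `n` steps. -/
noncomputable def char : ℕ → ℂ → ℝ
  | 0 => fun _ => 1
  | n + 1 => W.transfer u (char n)

/-- Half the variance of a step in each coordinate. -/
noncomputable def halfVar : ℝ := (W.rotFlip + W.flip) / 4

theorem halfVar_pos : 0 < W.halfVar := by have := W.flip_pos; unfold halfVar; linarith

theorem halfVar_le : W.halfVar ≤ 1 / 4 := by
  have := W.sum_eq_one
  have := W.rot_nonneg
  have := W.back_nonneg
  unfold halfVar; linarith

variable {W u}

theorem transfer_abs_le {F : ℂ → ℝ} {G : ℂ → ℝ} {ξ : ℂ} {γ : ℝ} (hγ : |Real.cos ξ.re| ≤ γ)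
    (h1 : |F (u * ξ)| ≤ G (u * ξ)) (h2 : |F (conj u * ξ)| ≤ G (conj u * ξ)) (h3 : |F ξ| ≤ G ξ) :
    |W.transfer u F ξ| ≤ (W.rot + W.rotFlip * γ) * G (u * ξ) + W.back * G (conj u * ξ)
      + W.flip * γ * G ξ := by
  have r0 := W.rot_nonneg
  have r1 := W.rotFlip_nonneg
  have r2 := W.back_nonneg
  have r3 := W.flip_nonneg
  have hγ0 : 0 ≤ γ := (abs_nonneg _).trans hγ
  unfold transfer
  refine (abs_add_le _ _).trans (add_le_add ((abs_add_le _ _).trans (add_le_add ?_ ?_)) ?_)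
  · rw [abs_mul]
    gcongr
    refine (abs_add_le _ _).trans (add_le_add (abs_of_nonneg r0).le ?_)
    rw [abs_mul, abs_of_nonneg r1]
    gcongr
  · rw [abs_mul, abs_of_nonneg r2]
    gcongr
  · rw [abs_mul, abs_mul, abs_of_nonneg r3]
    gcongr

/-- If every frequency of length `R` is rotated within `L` steps to one where the cosine is bounded
away from `±1`, then the characteristic functions decay exponentially there, at rate `1 / L`. -/
theorem abs_char_le_of_gap (hu : ‖u‖ = 1) {δ R : ℝ} (hδ : 0 < δ) (hδ1 : δ ≤ 1) {L : ℕ}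
    (hgap : ∀ ξ : ℂ, ‖ξ‖ = R → ∃ j ≤ L, |Real.cos ((u ^ j * ξ).re)| ≤ 1 - δ)
    (n : ℕ) (ξ : ℂ) (hξ : ‖ξ‖ = R) :
    |W.char u n ξ| ≤ 2 * (1 - δ * (W.rotFlip + W.flip) * (W.rot + W.rotFlip - W.back)
      / (4 * (L + 1))) ^ n := by
  have r0 := W.rot_nonneg
  have r1 := W.rotFlip_nonneg
  have r2 := W.back_nonneg
  have r3 := W.flip_nonneg
  have r4 := W.sum_eq_one
  have r5 := W.drift
  have r6 := W.flip_pos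
  have huc : conj u * u = 1 := by
    rw [mul_comm, Complex.mul_conj, Complex.normSq_eq_norm_sq, hu]; norm_num
  have hcn : ‖conj u‖ = 1 := by simpa using hu
  -- The number of rotations by `u` until the cosine is damped. A step by `u` lowers it at an
  -- undamped frequency, and a step by `conj u` raises it by at most one.
  set d : ℂ → ℕ := fun ξ => sInf {j | |Real.cos ((u ^ j * ξ).re)| ≤ 1 - δ} with hd
  have hdmem : ∀ ξ : ℂ, ‖ξ‖ = R → |Real.cos ((u ^ d ξ * ξ).re)| ≤ 1 - δ := fun ξ h =>
    Nat.sInf_mem (s := {j | |Real.cos ((u ^ j * ξ).re)| ≤ 1 - δ})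
      (let ⟨j, _, hj⟩ := hgap ξ h; ⟨j, hj⟩)
  have hdle : ∀ (ξ : ℂ) (j : ℕ), |Real.cos ((u ^ j * ξ).re)| ≤ 1 - δ → d ξ ≤ j := fun ξ j h =>
    Nat.sInf_le (s := {j | |Real.cos ((u ^ j * ξ).re)| ≤ 1 - δ}) h
  have hdL : ∀ ξ : ℂ, ‖ξ‖ = R → d ξ ≤ L := fun ξ h =>
    let ⟨j, hjL, hj⟩ := hgap ξ h; (hdle ξ j hj).trans hjL
  have hback : ∀ ξ : ℂ, ‖ξ‖ = R → d (conj u * ξ) ≤ d ξ + 1 := fun ξ h => by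
    refine hdle _ _ ?_
    have : u ^ (d ξ + 1) * (conj u * ξ) = u ^ d ξ * ξ := by
      rw [pow_succ]; linear_combination u ^ d ξ * ξ * huc
    rw [this]; exact hdmem ξ h
  have hfwd : ∀ ξ : ℂ, ‖ξ‖ = R → ¬ |Real.cos ξ.re| ≤ 1 - δ → d (u * ξ) + 1 ≤ d ξ := fun ξ h hn => by
    have h0 : d ξ ≠ 0 := fun h0 => by
      have := hdmem ξ h
      rw [h0] at this
      exact hn (by simpa using this)
    obtain ⟨m, hm⟩ := Nat.exists_eq_succ_of_ne_zero h0
    have : d (u * ξ) ≤ m := by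
      refine hdle _ _ ?_
      have h1 := hdmem ξ h
      rwa [hm, pow_succ, mul_assoc] at h1
    omega
  set p := W.rotFlip + W.flip with hp
  set D := W.rot + W.rotFlip - W.back with hD
  -- Slope of the Lyapunov function `w = 1 + s d`, for which one step contracts `w` by `1 - η`. At a
  -- damped frequency the gain `δ p` pays for the largest possible rise `s L + s = δ p / 2`.
  -- Elsewhere the drift lowers `w` by `s D = 2 η` on average, which is at least `η w` because `w ≤
  -- 2`.
  set s : ℝ := δ * p / (2 * (L + 1)) with hs
  have hL0 : (0 : ℝ) < L + 1 := by positivity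
  have hsL : s * (L + 1) = δ * p / 2 := by rw [hs]; field_simp
  have hp1 : p ≤ 1 := by rw [hp]; linarith
  have hD0 : 0 < D := by rw [hD]; linarith
  have hD1 : D ≤ 1 := by rw [hD]; linarith
  have hs0 : 0 < s := by positivity
  have hη : δ * p * D / (4 * (L + 1)) = s * D / 2 := by rw [hs]; field_simp; norm_num
  rw [hη]
  set η := s * D / 2 with hη'
  have hL0' : (0 : ℝ) ≤ L := by positivity
  have hδp : δ * p ≤ 1 := by nlinarith
  have hs1 : s ≤ δ * p / 2 := by nlinarith
  have hη0 : 0 < η := by positivity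
  have hηs : η ≤ s / 2 := by rw [hη']; nlinarith
  have hη1 : 0 ≤ 1 - η := by linarith
  set w : ℂ → ℝ := fun ξ => 1 + s * d ξ with hw
  have hw1 : ∀ ξ, ‖ξ‖ = R → s * d ξ ≤ s * L := fun ξ h => by
    have : (d ξ : ℝ) ≤ L := by exact_mod_cast hdL ξ h
    gcongr
  have key : ∀ n, ∀ ξ : ℂ, ‖ξ‖ = R → |W.char u n ξ| ≤ (1 - η) ^ n * w ξ := by
    intro n
    induction n with
    | zero =>
      intro ξ h
      simp only [char, pow_zero, one_mul, hw, abs_one]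
      have : 0 ≤ s * d ξ := by positivity
      linarith
    | succ n ih =>
      intro ξ h
      have hu' : ‖u * ξ‖ = R := by rw [norm_mul, hu, h, one_mul]
      have hc' : ‖conj u * ξ‖ = R := by rw [norm_mul, hcn, h, one_mul]
      have hpow : 0 ≤ (1 - η) ^ n := pow_nonneg hη1 n
      simp only [char]
      rw [pow_succ, mul_assoc]
      have hb : (d (conj u * ξ) : ℝ) ≤ d ξ + 1 := by exact_mod_cast hback ξ h
      have hbs := mul_le_mul_of_nonneg_left hb hs0.le
      have hdw := hw1 ξ h
      have hduw := hw1 (u * ξ) hu'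
      have hd0 : 0 ≤ s * d ξ := by positivity
      by_cases hbad : |Real.cos ξ.re| ≤ 1 - δ
      · refine (transfer_abs_le (G := fun ξ => (1 - η) ^ n * w ξ) hbad (ih _ hu') (ih _ hc')
          (ih _ h)).trans ?_
        have hd0 : d ξ = 0 := by
          have := hdle ξ 0 (by simpa using hbad)
          omega
        have : (W.rot + W.rotFlip * (1 - δ)) * w (u * ξ) + W.back * w (conj u * ξ)
            + W.flip * (1 - δ) * w ξ ≤ (1 - η) * w ξ := by
          simp only [hw]
          rw [hd0] at hbs ⊢
          simp only [Nat.cast_zero, mul_zero, add_zero, mul_one, zero_add] at hbs ⊢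
          have hδf : 0 ≤ W.rotFlip * δ := mul_nonneg r1 hδ.le
          have hδf' : 0 ≤ W.rotFlip * (1 - δ) := mul_nonneg r1 (by linarith)
          have hq : (W.rot + W.rotFlip * (1 - δ)) ≤ 1 := by linarith
          have hq0 : 0 ≤ (W.rot + W.rotFlip * (1 - δ)) := by linarith
          have a1 : (W.rot + W.rotFlip * (1 - δ)) * (s * d (u * ξ)) ≤ s * L :=
            (mul_le_mul_of_nonneg_left hduw hq0).trans
              (mul_le_of_le_one_left (mul_nonneg hs0.le hL0') hq)
          have a2 : W.back * (s * d (conj u * ξ)) ≤ s :=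
            (mul_le_mul_of_nonneg_left hbs r2).trans
              (mul_le_of_le_one_left hs0.le (by linarith))
          have a3 : W.rot + W.rotFlip * (1 - δ) + W.back + W.flip * (1 - δ) = 1 - δ * p := by
            rw [hp]; linear_combination r4
          linarith
        calc _ = (1 - η) ^ n * ((W.rot + W.rotFlip * (1 - δ)) * w (u * ξ)
                + W.back * w (conj u * ξ) + W.flip * (1 - δ) * w ξ) := by ring
          _ ≤ _ := by gcongr
      · refine (transfer_abs_le (G := fun ξ => (1 - η) ^ n * w ξ) (Real.abs_cos_le_one _)
          (ih _ hu') (ih _ hc') (ih _ h)).trans ?_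
        have hf : (d (u * ξ) : ℝ) + 1 ≤ d ξ := by exact_mod_cast hfwd ξ h hbad
        have hfs := mul_le_mul_of_nonneg_left hf hs0.le
        have : (W.rot + W.rotFlip * 1) * w (u * ξ) + W.back * w (conj u * ξ)
            + W.flip * 1 * w ξ ≤ (1 - η) * w ξ := by
          have e1 : w (u * ξ) ≤ w ξ - s := by simp only [hw]; linarith
          have e2 : w (conj u * ξ) ≤ w ξ + s := by simp only [hw]; linarith
          have e3 : w ξ ≤ 2 := by simp only [hw]; linarith
          have e4 : (W.rot + W.rotFlip) * w (u * ξ) ≤ (W.rot + W.rotFlip) * (w ξ - s) := by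
            gcongr
          have e5 : W.back * w (conj u * ξ) ≤ W.back * (w ξ + s) := by gcongr
          have e6 : η * w ξ ≤ η * 2 := by gcongr
          have e7 : (W.rot + W.rotFlip + W.back + W.flip) * w ξ = w ξ := by rw [r4, one_mul]
          have e8 : η * 2 = s * (W.rot + W.rotFlip - W.back) := by rw [hη', hD]; ring
          linarith
        calc _ = (1 - η) ^ n * ((W.rot + W.rotFlip * 1) * w (u * ξ)
                + W.back * w (conj u * ξ) + W.flip * 1 * w ξ) := by ring
          _ ≤ _ := by gcongr
  refine (key n ξ hξ).trans ?_
  rw [mul_comm]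
  have : w ξ ≤ 2 := by simp only [hw]; have := hw1 ξ hξ; nlinarith
  have hpow : 0 ≤ (1 - η) ^ n := pow_nonneg hη1 n
  gcongr

/-- Stretched-exponential decay of the characteristic functions away from the origin, up to a
linear factor in the frequency. -/
theorem exists_abs_char_le {θ : ℝ} (hrat : ∃ q : ℚ, Real.cos θ = q)
    (hhalf : ¬ ∃ k : ℤ, Real.cos θ = k / 2) (W : StepWeights) {κ : ℝ} (hκ : 0 < κ) :
    ∃ c : ℝ, 0 < c ∧ ∀ (n : ℕ) (ξ : ℂ), κ ≤ ‖ξ‖ →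
      |W.char (Complex.exp (θ * Complex.I)) n ξ| ≤ 8 * (‖ξ‖ + 2) * Real.exp (-c * √n) := by
  obtain ⟨δ, hδ, hδ1, hgap⟩ := exists_abs_cos_le hrat hhalf hκ
  set u := Complex.exp (θ * Complex.I)
  have hunorm : ‖u‖ = 1 := Complex.norm_exp_ofReal_mul_I θ
  have hD : 0 < W.rot + W.rotFlip - W.back := by linarith [W.drift]
  have hp := W.flip_pos
  set A := δ * (W.rotFlip + W.flip) * (W.rot + W.rotFlip - W.back) / 4 with hA
  have hA0 : 0 < A := by positivity
  have hl : 0 < Real.log 2 := Real.log_pos (by norm_num)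
  refine ⟨2 * √(A * (Real.log 2 / 2)), by positivity, fun n ξ hξ => ?_⟩
  have hex : ∃ k : ℕ, ‖ξ‖ + 1 < 2 ^ k := pow_unbounded_of_one_lt _ (by norm_num)
  -- Minimality of `k` keeps `2 ^ k` within a constant factor of `‖ξ‖ + 1`.
  set k := Nat.find hex with hk
  have hk1 : ‖ξ‖ + 1 < 2 ^ k := Nat.find_spec hex
  have hk2 : (2 : ℝ) ^ k ≤ 2 * (‖ξ‖ + 1) := by
    have h0 : k ≠ 0 := fun h0 => by rw [h0] at hk1; norm_num at hk1; linarith [norm_nonneg ξ]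
    obtain ⟨m, hm⟩ := Nat.exists_eq_succ_of_ne_zero h0
    have := Nat.find_min hex (m := m) (by omega)
    rw [hm, pow_succ]; linarith
  have h1 := abs_char_le_of_gap (W := W) (u := u) hunorm hδ hδ1 (R := ‖ξ‖) (L := 2 * k + 1)
    (fun ζ hζ => hgap ζ (hζ ▸ hξ) k (hζ ▸ hk1)) n ξ rfl
  have h2 : δ * (W.rotFlip + W.flip) * (W.rot + W.rotFlip - W.back) / (4 * (((2 * k + 1 : ℕ) : ℝ) + 1))
      = A / (2 * k + 2) := by rw [hA]; push_cast; field_simp; ring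
  rw [h2] at h1
  have hK : (0 : ℝ) < 2 * k + 2 := by positivity
  have h3 : (1 - A / (2 * k + 2)) ^ n ≤ Real.exp (-(A / (2 * k + 2)) * n) := by
    have hle : 1 - A / (2 * k + 2) ≤ Real.exp (-(A / (2 * k + 2))) := by
      linarith [Real.add_one_le_exp (-(A / (2 * (k : ℝ) + 2)))]
    have h0 : 0 ≤ 1 - A / (2 * k + 2) := by
      rw [sub_nonneg, div_le_one hK]
      have r0 := W.rot_nonneg
      have r1 := W.rotFlip_nonneg
      have r2 := W.back_nonneg
      have r3 := W.flip_nonneg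
      have r4 := W.sum_eq_one
      have : δ * (W.rotFlip + W.flip) * (W.rot + W.rotFlip - W.back) ≤ 1 :=
        mul_le_one₀ (mul_le_one₀ hδ1 hp.le (by linarith)) hD.le (by linarith)
      have : (0 : ℝ) ≤ k := by positivity
      rw [hA]; linarith
    calc _ ≤ (Real.exp (-(A / (2 * k + 2)))) ^ n := by gcongr
      _ = _ := by rw [← Real.exp_nat_mul]; ring_nf
  -- AM-GM: the product of `A n / (2 k + 2)` and `(k + 1) log 2` does not depend on `k`, so the
  -- decay rate becomes uniform in `ξ` at the cost of a factor `2 ^ (k + 1)`.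
  have h4 : -(A / (2 * k + 2)) * n ≤ -(2 * √(A * (Real.log 2 / 2))) * √n + (k + 1) * Real.log 2 := by
    have hm : √(A / (2 * k + 2) * n) * √((k + 1) * Real.log 2) = √(A * (Real.log 2 / 2)) * √n := by
      rw [← Real.sqrt_mul (by positivity), ← Real.sqrt_mul (by positivity)]
      congr 1; field_simp
    have := sq_nonneg (√(A / (2 * k + 2) * n) - √((k + 1) * Real.log 2))
    rw [sub_sq, Real.sq_sqrt (by positivity), Real.sq_sqrt (by positivity), mul_assoc 2, hm] at this
    linarith
  have h5 : Real.exp (((k : ℝ) + 1) * Real.log 2) = 2 * 2 ^ k := by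
    have : (k : ℝ) + 1 = ((k + 1 : ℕ) : ℝ) := by push_cast; ring
    rw [this, Real.exp_nat_mul, Real.exp_log (by norm_num), pow_succ, mul_comm]
  calc _ ≤ _ := h1
    _ ≤ 2 * Real.exp (-(2 * √(A * (Real.log 2 / 2))) * √n + (k + 1) * Real.log 2) := by
      gcongr; exact h3.trans (Real.exp_le_exp.2 h4)
    _ = 4 * 2 ^ k * Real.exp (-(2 * √(A * (Real.log 2 / 2))) * √n) := by
      rw [Real.exp_add, h5]; ring
    _ ≤ _ := by
      have : 4 * 2 ^ k ≤ 8 * (‖ξ‖ + 2) := by linarith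
      gcongr

/-- A quadratic corrector turns the Gaussian into an approximate eigenfunction of the transfer
operator. -/
theorem exists_corrector (hu : ‖u‖ = 1) (hu2 : (u ^ 2).re < 1) :
    ∃ C : ℂ, ∃ K : ℝ, 0 < K ∧ ∀ ξ : ℂ, ‖ξ‖ ≤ 1 →
      |W.transfer u (fun ζ => 1 + (C * ζ ^ 2).re) ξ
        - Real.exp (-W.halfVar * ‖ξ‖ ^ 2) * (1 + (C * ξ ^ 2).re)| ≤ K * (‖ξ‖ ^ 2) ^ 2 := by
  have r0 := W.rot_nonneg
  have r1 := W.rotFlip_nonneg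
  have r2 := W.back_nonneg
  have r3 := W.flip_nonneg
  have r4 := W.sum_eq_one
  have r5 := W.drift
  have hq := W.halfVar_pos
  have hq4 := W.halfVar_le
  have hqd : W.rotFlip + W.flip = 4 * W.halfVar := by unfold halfVar; ring
  set q := W.halfVar
  -- To leading order, the transfer operator sends `Re (C ζ ^ 2)` to `Re (C (1 + Λ) ξ ^ 2)`. The
  -- choice `C Λ = q` adds `q Re (ξ ^ 2)`, which cancels the anisotropic part of `-2 q (Re ξ) ^ 2 =
  -- -q ‖ξ‖ ^ 2 - q Re (ξ ^ 2)`.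
  set Λ : ℂ := ((W.rot + W.rotFlip : ℝ) : ℂ) * u ^ 2 + (W.back : ℂ) * (conj u) ^ 2 + (W.flip : ℂ) - 1
    with hΛ
  have hΛ0 : Λ ≠ 0 := by
    intro h0
    have h1 := congrArg Complex.re h0
    have h2 : ((conj u) ^ 2).re = (u ^ 2).re := by rw [← map_pow, Complex.conj_re]
    rw [hΛ, Complex.sub_re, Complex.add_re, Complex.add_re, Complex.re_ofReal_mul,
      Complex.re_ofReal_mul, h2, Complex.ofReal_re, Complex.one_re, Complex.zero_re] at h1
    have h3 : (W.rot + W.rotFlip + W.back) * ((u ^ 2).re - 1) = 0 := by linear_combination h1 - r4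
    rcases mul_eq_zero.1 h3 with h | h <;> linarith
  refine ⟨(q : ℂ) / Λ, 4 * q + ‖(q : ℂ) / Λ‖ / 2 + q ^ 2 * (1 + ‖(q : ℂ) / Λ‖)
    + q * ‖(q : ℂ) / Λ‖, by positivity, fun ξ hξ => ?_⟩
  set C := (q : ℂ) / Λ with hC
  have hCΛ : C * Λ = q := by rw [hC]; field_simp
  set t := ‖ξ‖ ^ 2 with ht
  have ht0 : 0 ≤ t := by positivity
  have ht1 : t ≤ 1 := pow_le_one₀ (norm_nonneg _) hξ
  have hh : ∀ v : ℂ, ‖v‖ = 1 → |(C * (v * ξ) ^ 2).re| ≤ ‖C‖ * t := fun v hv => by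
    refine (Complex.abs_re_le_norm _).trans ?_
    rw [norm_mul, norm_pow, norm_mul, hv, one_mul]
  have hh1 : |(C * ξ ^ 2).re| ≤ ‖C‖ * t := by simpa using hh 1 (by simp)
  have hhu := hh u hu
  have htn : t = ξ.re ^ 2 + ξ.im ^ 2 := by rw [ht, Complex.sq_norm, Complex.normSq_apply]; ring
  have hξ2 : (ξ ^ 2).re = ξ.re ^ 2 - ξ.im ^ 2 := by rw [pow_two, Complex.mul_re]; ring
  have hP : (W.rot + W.rotFlip) * (C * (u * ξ) ^ 2).re + W.back * (C * (conj u * ξ) ^ 2).re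
      + W.flip * (C * ξ ^ 2).re = (C * ξ ^ 2).re + q * (ξ ^ 2).re := by
    rw [← Complex.re_ofReal_mul, ← Complex.re_ofReal_mul, ← Complex.re_ofReal_mul,
      ← Complex.re_ofReal_mul, ← Complex.add_re, ← Complex.add_re, ← Complex.add_re]
    congr 1
    rw [hΛ] at hCΛ
    linear_combination ξ ^ 2 * hCΛ
  set ψ := 1 - Real.cos ξ.re with hψ
  have hre : |ξ.re| ≤ 1 := (Complex.abs_re_le_norm ξ).trans hξ
  have hret : ξ.re ^ 2 ≤ t := by rw [htn]; nlinarith [sq_nonneg ξ.im]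
  have hψ0 : 0 ≤ ψ := by have := Real.cos_le_one ξ.re; linarith
  have hψ1 : ψ ≤ t / 2 := by have := Real.one_sub_sq_div_two_le_cos (x := ξ.re); linarith
  have hψ2 : |ψ - ξ.re ^ 2 / 2| ≤ t ^ 2 := by
    have h1 := Real.cos_bound hre
    have h2 : |ξ.re| ^ 4 ≤ t ^ 2 := by
      calc |ξ.re| ^ 4 = (ξ.re ^ 2) ^ 2 := by rw [← sq_abs ξ.re]; ring
        _ ≤ t ^ 2 := by gcongr
    have h3 : ψ - ξ.re ^ 2 / 2 = -(Real.cos ξ.re - (1 - ξ.re ^ 2 / 2)) := by rw [hψ]; ring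
    rw [h3, abs_neg]
    nlinarith [abs_nonneg ξ.re, sq_nonneg t]
  have he : |Real.exp (-q * t) - 1 - (-q * t)| ≤ q ^ 2 * t ^ 2 := by
    have h1 : |-q * t| ≤ 1 := by
      rw [abs_mul, abs_neg, abs_of_pos hq, abs_of_nonneg ht0]; nlinarith
    have := Real.abs_exp_sub_one_sub_id_le h1
    calc _ ≤ _ := this
      _ = _ := by ring
  set E := Real.exp (-q * t) - 1 - (-q * t) with hE
  set H := (C * ξ ^ 2).re with hH
  set Hu := (C * (u * ξ) ^ 2).re with hHu
  have hmain : W.transfer u (fun ζ => 1 + (C * ζ ^ 2).re) ξ - Real.exp (-q * t) * (1 + H)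
      = -(4 * q * (ψ - ξ.re ^ 2 / 2)) - ψ * (W.rotFlip * Hu + W.flip * H) - E * (1 + H)
        + q * t * H := by
    have hexp : Real.exp (-q * t) = E + 1 - q * t := by rw [hE]; ring
    have hcos : Real.cos ξ.re = 1 - ψ := by rw [hψ]; ring
    simp only [transfer, ← hH, ← hHu]
    rw [hexp, hcos]
    linear_combination hP - ψ * hqd + r4 + q * htn + q * hξ2
  rw [hmain]
  have b1 : |4 * q * (ψ - ξ.re ^ 2 / 2)| ≤ 4 * q * t ^ 2 := by
    rw [abs_mul, abs_of_pos (by positivity)]; gcongr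
  have b2 : |ψ * (W.rotFlip * Hu + W.flip * H)| ≤ t / 2 * (‖C‖ * t) := by
    rw [abs_mul, abs_of_nonneg hψ0]
    gcongr
    refine (abs_add_le _ _).trans ?_
    rw [abs_mul, abs_mul, abs_of_nonneg r1, abs_of_nonneg r3]
    have e1 := mul_le_mul_of_nonneg_left hhu r1
    have e2 := mul_le_mul_of_nonneg_left hh1 r3
    have e3 : (W.rotFlip + W.flip) * (‖C‖ * t) ≤ 1 * (‖C‖ * t) := by
      gcongr; linarith
    linarith
  have b3 : |E * (1 + H)| ≤ q ^ 2 * t ^ 2 * (1 + ‖C‖) := by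
    rw [abs_mul]
    gcongr
    refine (abs_add_le _ _).trans ?_
    rw [abs_one]
    have : ‖C‖ * t ≤ ‖C‖ * 1 := by gcongr
    linarith
  have b4 : |q * t * H| ≤ q * t * (‖C‖ * t) := by
    rw [abs_mul, abs_of_nonneg (by positivity)]; gcongr
  rw [abs_le] at b1 b2 b3 b4 ⊢
  constructor <;> linarith

set_option maxHeartbeats 1000000 in
/-- Gaussian approximation of the characteristic functions near the origin. -/
theorem exists_abs_char_sub_exp_le (hu : ‖u‖ = 1) (hu2 : (u ^ 2).re < 1) :
    ∃ κ : ℝ, 0 < κ ∧ ∃ A : ℝ, 0 < A ∧ ∀ n : ℕ, 0 < n → ∀ ξ : ℂ, ‖ξ‖ ≤ κ →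
      |W.char u n ξ - Real.exp (-(n * W.halfVar * ‖ξ‖ ^ 2))|
        ≤ A / n * Real.exp (-(W.halfVar / 4 * n * ‖ξ‖ ^ 2)) := by
  obtain ⟨C, K, hK, hcorr⟩ := exists_corrector (W := W) hu hu2
  have r0 := W.rot_nonneg
  have r1 := W.rotFlip_nonneg
  have r2 := W.back_nonneg
  have r3 := W.flip_nonneg
  have hq := W.halfVar_pos
  have hq4 := W.halfVar_le
  set q := W.halfVar
  have hcn : ‖conj u‖ = 1 := by simpa using hu
  -- The three bounds on `‖ξ‖ ^ 2` give, in turn, the range of the Taylor estimates, `1 + h ∈ [1/2,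
  -- 2]`, and a corrector error that fits into the gap `e - e ^ 2`.
  set τ₀ : ℝ := min (min 1 (1 / (2 * (‖C‖ + 1)))) (q * Real.exp (-q) / (4 * K)) with hτ
  have hτ0 : 0 < τ₀ := by positivity
  refine ⟨√τ₀, by positivity, 8 * (2 * ‖C‖ + 4 * K) * (1 / q + 16 / q ^ 2) + ‖C‖ * (4 / (3 * q)) + 1,
    by positivity, fun n hn ξ hξ => ?_⟩
  set t := ‖ξ‖ ^ 2 with ht
  have ht0 : 0 ≤ t := by positivity
  have htτ : t ≤ τ₀ := by
    calc t ≤ √τ₀ ^ 2 := by rw [ht]; gcongr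
      _ = τ₀ := Real.sq_sqrt hτ0.le
  have ht1 : t ≤ 1 := htτ.trans ((min_le_left _ _).trans (min_le_left _ _))
  have htC : ‖C‖ * t ≤ 1 / 2 := by
    have h1 : t ≤ 1 / (2 * (‖C‖ + 1)) := htτ.trans ((min_le_left _ _).trans (min_le_right _ _))
    rw [le_div_iff₀ (by positivity)] at h1
    nlinarith
  have htK : K * t ≤ q * Real.exp (-q) / 4 := by
    have h1 : t ≤ q * Real.exp (-q) / (4 * K) := htτ.trans (min_le_right _ _)
    rw [le_div_iff₀ (by positivity)] at h1
    linarith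
  set h : ℂ → ℝ := fun ζ => (C * ζ ^ 2).re with hh
  have hh0 : ∀ ζ : ℂ, ‖ζ‖ ^ 2 = t → |h ζ| ≤ ‖C‖ * t := fun ζ hζ => by
    refine (Complex.abs_re_le_norm _).trans ?_
    rw [norm_mul, norm_pow, hζ]
  have hw : ∀ ζ : ℂ, ‖ζ‖ ^ 2 = t → 1 / 2 ≤ 1 + h ζ ∧ 1 + h ζ ≤ 2 := fun ζ hζ => by
    have := hh0 ζ hζ
    rw [abs_le] at this
    constructor <;> linarith
  have hnorm1 : ∀ ζ : ℂ, ‖ζ‖ ^ 2 = t → ‖ζ‖ ≤ 1 := fun ζ hζ => by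
    rw [← hζ] at ht1
    exact (sq_le_one_iff₀ (norm_nonneg _)).1 ht1
  -- The square root of the true multiplier. Measuring errors at the slower rate `e` makes `1 + h`
  -- an exact supersolution, so that errors propagate without loss.
  set e := Real.exp (-(q * t / 2)) with he
  have he2 : Real.exp (-q * t) = e ^ 2 := by rw [he, ← Real.exp_nat_mul]; push_cast; ring_nf
  have hep : 0 < e := Real.exp_pos _
  have he1 : e ≤ 1 := Real.exp_le_one_iff.2 (by nlinarith)
  have heinv : 1 ≤ 2 * e := by
    have : -(q * t / 2) + 1 ≤ e := Real.add_one_le_exp _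
    nlinarith
  have hgap : 2 * (K * t ^ 2) ≤ e - e ^ 2 := by
    have h1 : q * t / 2 * e ≤ 1 - e := by
      have h2 := Real.add_one_le_exp (q * t / 2)
      have h3 : Real.exp (q * t / 2) * e = 1 := by rw [he, ← Real.exp_add]; simp
      nlinarith
    have h4 : Real.exp (-q) ≤ e ^ 2 := by rw [← he2]; apply Real.exp_le_exp.2; nlinarith
    have h5 : K * t ^ 2 ≤ q * Real.exp (-q) / 4 * t := by nlinarith
    have h6 : q * Real.exp (-q) * t ≤ q * e ^ 2 * t := by gcongr
    nlinarith
  have hee : 0 ≤ e - e ^ 2 := (by positivity : (0 : ℝ) ≤ 2 * (K * t ^ 2)).trans hgap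
  have hcos : ∀ ζ : ℂ, ‖ζ‖ ^ 2 = t → 0 ≤ Real.cos ζ.re := fun ζ hζ =>
    Real.cos_nonneg_of_mem_Icc (by
      have := abs_le.1 ((Complex.abs_re_le_norm ζ).trans (hnorm1 ζ hζ))
      have := Real.pi_gt_three
      constructor <;> linarith)
  have hT : ∀ ζ : ℂ, ‖ζ‖ ^ 2 = t → W.transfer u (fun ζ => 1 + h ζ) ζ ≤ e * (1 + h ζ) := fun ζ hζ => by
    have h1 := (abs_le.1 (hcorr ζ (hnorm1 ζ hζ))).2
    rw [hζ, he2] at h1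
    have h2 := (hw ζ hζ).1
    have h3 := mul_le_mul_of_nonneg_left h2 hee
    simp only [hh] at h3 ⊢
    linarith
  -- The first term is the initial error `|h|`; each step adds at most `e ^ m * K t ^ 2`, which is
  -- absorbed using `1 ≤ 4 e (1 + h)`.
  have key : ∀ m : ℕ, ∀ ζ : ℂ, ‖ζ‖ ^ 2 = t →
      |W.char u m ζ - (e ^ 2) ^ m * (1 + h ζ)|
        ≤ (2 * ‖C‖ * t + 4 * K * t ^ 2 * m) * e ^ m * (1 + h ζ) := by
    intro m
    induction m with
    | zero =>
      intro ζ hζ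
      have h1 := hh0 ζ hζ
      have h2 := (hw ζ hζ).1
      simp only [char, pow_zero, one_mul, Nat.cast_zero, mul_zero, add_zero, mul_one]
      rw [show 1 - (1 + h ζ) = -h ζ by ring, abs_neg]
      have h4 := mul_le_mul_of_nonneg_left h2 (mul_nonneg (norm_nonneg C) ht0)
      linarith
    | succ m ih =>
      intro ζ hζ
      have hζu : ‖u * ζ‖ ^ 2 = t := by rw [norm_mul, hu, one_mul, hζ]
      have hζc : ‖conj u * ζ‖ ^ 2 = t := by rw [norm_mul, hcn, one_mul, hζ]
      have hc := hcos ζ hζ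
      set B := (2 * ‖C‖ * t + 4 * K * t ^ 2 * m) * e ^ m with hB
      have hB0 : 0 ≤ B := by positivity
      have h1 : |W.transfer u (fun ζ => W.char u m ζ - (e ^ 2) ^ m * (1 + h ζ)) ζ|
          ≤ B * W.transfer u (fun ζ => 1 + h ζ) ζ := by
        refine (transfer_abs_le (G := fun ζ => B * (1 + h ζ)) (abs_of_nonneg hc).le
          (ih _ hζu) (ih _ hζc) (ih _ hζ)).trans (le_of_eq ?_)
        unfold transfer; ring
      have h2 := hcorr ζ (hnorm1 ζ hζ)
      rw [hζ, he2] at h2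
      have h3 := hT ζ hζ
      have h4 : W.char u (m + 1) ζ - (e ^ 2) ^ (m + 1) * (1 + h ζ)
          = W.transfer u (fun ζ => W.char u m ζ - (e ^ 2) ^ m * (1 + h ζ)) ζ
            + (e ^ 2) ^ m * (W.transfer u (fun ζ => 1 + h ζ) ζ - e ^ 2 * (1 + h ζ)) := by
        simp only [char]; unfold transfer; ring
      rw [h4]
      refine (abs_add_le _ _).trans ?_
      rw [abs_mul, abs_of_pos (show 0 < (e ^ 2) ^ m by positivity)]
      have h5 : B * W.transfer u (fun ζ => 1 + h ζ) ζ ≤ B * (e * (1 + h ζ)) := by gcongr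
      have h6 : (e ^ 2) ^ m * |W.transfer u (fun ζ => 1 + h ζ) ζ - e ^ 2 * (1 + h ζ)|
          ≤ e ^ m * (K * t ^ 2) := by
        have : (e ^ 2) ^ m ≤ e ^ m := pow_le_pow_left₀ (by positivity) (by linarith) m
        exact mul_le_mul this h2 (abs_nonneg _) (by positivity)
      have h7 : e ^ m * (K * t ^ 2) ≤ 4 * K * t ^ 2 * e ^ (m + 1) * (1 + h ζ) := by
        have h8 : 1 ≤ 4 * e * (1 + h ζ) := by
          have := mul_le_mul_of_nonneg_left (hw ζ hζ).1 (show 0 ≤ 4 * e by positivity)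
          linarith
        have : 0 ≤ e ^ m * (K * t ^ 2) := by positivity
        calc e ^ m * (K * t ^ 2) ≤ e ^ m * (K * t ^ 2) * (4 * e * (1 + h ζ)) :=
              le_mul_of_one_le_right this h8
          _ = _ := by ring
      calc _ ≤ B * (e * (1 + h ζ)) + 4 * K * t ^ 2 * e ^ (m + 1) * (1 + h ζ) := by linarith
        _ = _ := by rw [hB]; push_cast; ring
  have hn0 : (0 : ℝ) < n := by exact_mod_cast hn
  have h1 := key n ξ rfl
  have h2 := hw ξ rfl
  have h3 := hh0 ξ rfl
  -- In terms of `x`, the errors `t` and `n t ^ 2` are `x / n` and `x ^ 2 / n`; part of the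
  -- exponential absorbs the powers of `x`, leaving the factor `g`.
  set x := n * t with hx
  have hx0 : 0 ≤ x := by positivity
  have een : e ^ n = Real.exp (-(q / 2 * x)) := by
    rw [he, ← Real.exp_nat_mul]; congr 1; rw [hx]; ring
  have een2 : (e ^ 2) ^ n = Real.exp (-(q * x)) := by
    rw [← pow_mul, mul_comm 2 n, pow_mul, een, ← Real.exp_nat_mul]; congr 1; push_cast; ring
  have hgoal1 : Real.exp (-(n * q * t)) = Real.exp (-(q * x)) := by congr 1; rw [hx]; ring
  have hgoal2 : Real.exp (-(q / 4 * n * t)) = Real.exp (-(q / 4 * x)) := by congr 1; rw [hx]; ring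
  rw [hgoal1, hgoal2]
  rw [een, een2] at h1
  have hsplit : Real.exp (-(q / 2 * x)) = Real.exp (-(q / 4 * x)) * Real.exp (-(q / 4 * x)) := by
    rw [← Real.exp_add]; congr 1; ring
  have hsplit2 : Real.exp (-(q / 4 * x)) = Real.exp (-(q / 8 * x)) * Real.exp (-(q / 8 * x)) := by
    rw [← Real.exp_add]; congr 1; ring
  have hsplit3 : Real.exp (-(q * x)) = Real.exp (-(q / 4 * x)) * Real.exp (-(3 * q / 4 * x)) := by
    rw [← Real.exp_add]; congr 1; ring
  set g := Real.exp (-(q / 4 * x)) with hg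
  have hg0 : 0 < g := Real.exp_pos _
  have m1 : x * g ≤ 1 / (q / 4) := mul_exp_neg_le (by positivity)
  have m2 : x ^ 2 * g ≤ (1 / (q / 8)) ^ 2 := by
    have := mul_exp_neg_le (a := q / 8) (x := x) (by positivity)
    calc x ^ 2 * g = (x * Real.exp (-(q / 8 * x))) ^ 2 := by rw [hsplit2]; ring
      _ ≤ _ := by gcongr
  have m3 : x * Real.exp (-(3 * q / 4 * x)) ≤ 1 / (3 * q / 4) := mul_exp_neg_le (by positivity)
  have htx : t = x / n := by rw [hx]; field_simp
  have f1 : |W.char u n ξ - Real.exp (-(q * x)) * (1 + h ξ)|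
      ≤ 2 * ((2 * ‖C‖ + 4 * K) * (x * g + x ^ 2 * g)) / n * g := by
    refine h1.trans ?_
    calc (2 * ‖C‖ * t + 4 * K * t ^ 2 * n) * Real.exp (-(q / 2 * x)) * (1 + h ξ)
        ≤ (2 * ‖C‖ * t + 4 * K * t ^ 2 * n) * Real.exp (-(q / 2 * x)) * 2 := by
          gcongr; exact h2.2
      _ = 2 * (2 * ‖C‖ * (x * g) + 4 * K * (x ^ 2 * g)) / n * g := by
          rw [hsplit, htx]; field_simp
      _ ≤ _ := by
          gcongr
          have p1 : 0 ≤ x * g := by positivity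
          have p2 : 0 ≤ x ^ 2 * g := by positivity
          nlinarith [mul_nonneg (norm_nonneg C) p2, mul_nonneg hK.le p1]
  have f2 : |Real.exp (-(q * x)) * h ξ| ≤ ‖C‖ * (x * Real.exp (-(3 * q / 4 * x))) / n * g := by
    rw [abs_mul, abs_of_pos (Real.exp_pos _)]
    calc _ ≤ Real.exp (-(q * x)) * (‖C‖ * t) := by gcongr
      _ = _ := by rw [hsplit3, htx]; field_simp
  calc |W.char u n ξ - Real.exp (-(q * x))|
      = |(W.char u n ξ - Real.exp (-(q * x)) * (1 + h ξ)) + Real.exp (-(q * x)) * h ξ| := by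
        congr 1; ring
    _ ≤ 2 * ((2 * ‖C‖ + 4 * K) * (x * g + x ^ 2 * g)) / n * g
        + ‖C‖ * (x * Real.exp (-(3 * q / 4 * x))) / n * g :=
        (abs_add_le _ _).trans (add_le_add f1 f2)
    _ ≤ 2 * ((2 * ‖C‖ + 4 * K) * (1 / (q / 4) + (1 / (q / 8)) ^ 2)) / n * g
        + ‖C‖ * (1 / (3 * q / 4)) / n * g := by gcongr
    _ = (8 * (2 * ‖C‖ + 4 * K) * (1 / q + 16 / q ^ 2) + ‖C‖ * (4 / (3 * q))) / n * g := by
        field_simp; ring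
    _ ≤ _ := by
        gcongr ?_ / _ * _
        linarith

end StepWeights

/-! ### Planar Gaussians and Fourier inversion -/

open scoped ENNReal

theorem integrable_exp_neg_mul_sq_norm {b : ℝ} (hb : 0 < b) :
    Integrable fun v : ℂ => Real.exp (-b * ‖v‖ ^ 2) := by
  have h := GaussianFourier.integrable_cexp_neg_mul_sq_norm_add (V := ℂ) (b := (b : ℂ))
    (by simpa using hb) 0 0
  have h2 := h.norm
  refine h2.congr (Filter.Eventually.of_forall fun v => ?_)
  simp only [zero_mul, add_zero, Complex.norm_exp]
  congr 1
  rw [← Complex.ofReal_pow, ← Complex.ofReal_neg, ← Complex.ofReal_mul, Complex.ofReal_re]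

theorem integral_exp_neg_mul_sq_norm {b : ℝ} (hb : 0 < b) :
    ∫ v : ℂ, Real.exp (-b * ‖v‖ ^ 2) = Real.pi / b := by
  rw [GaussianFourier.integral_rexp_neg_mul_sq_norm hb, Complex.finrank_real_complex]
  norm_num

/-- The density of the centred isotropic Gaussian on the plane with variance `s ^ 2` in each
coordinate. -/
noncomputable def gaussianKernel (s : ℝ) (x : ℂ) : ℝ :=
  (2 * Real.pi * s ^ 2)⁻¹ * Real.exp (-(1 / (2 * s ^ 2)) * ‖x‖ ^ 2)

/-- The centred isotropic Gaussian on the plane with variance `s ^ 2` in each coordinate. -/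
noncomputable def planarGaussian (s : ℝ) : Measure ℂ :=
  volume.withDensity fun x => ENNReal.ofReal (gaussianKernel s x)

theorem gaussianKernel_nonneg (s : ℝ) (x : ℂ) : 0 ≤ gaussianKernel s x := by
  have := Real.pi_pos
  unfold gaussianKernel; positivity

theorem gaussianKernel_le (s : ℝ) (x : ℂ) : gaussianKernel s x ≤ (2 * Real.pi * s ^ 2)⁻¹ := by
  have := Real.pi_pos
  unfold gaussianKernel
  refine mul_le_of_le_one_right (by positivity) (Real.exp_le_one_iff.2 ?_)
  have : 0 ≤ 1 / (2 * s ^ 2) * ‖x‖ ^ 2 := by positivity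
  linarith

@[fun_prop]
theorem continuous_gaussianKernel (s : ℝ) : Continuous (gaussianKernel s) := by
  unfold gaussianKernel; fun_prop

theorem integrable_gaussianKernel {s : ℝ} (hs : 0 < s) : Integrable (gaussianKernel s) :=
  (integrable_exp_neg_mul_sq_norm (by positivity)).const_mul _

theorem integral_gaussianKernel {s : ℝ} (hs : 0 < s) : ∫ x, gaussianKernel s x = 1 := by
  have := Real.pi_pos
  unfold gaussianKernel
  rw [integral_const_mul, integral_exp_neg_mul_sq_norm (by positivity)]
  field_simp

theorem isProbabilityMeasure_planarGaussian {s : ℝ} (hs : 0 < s) :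
    IsProbabilityMeasure (planarGaussian s) := by
  constructor
  rw [planarGaussian, withDensity_apply _ MeasurableSet.univ, Measure.restrict_univ,
    ← ofReal_integral_eq_lintegral_ofReal (integrable_gaussianKernel hs)
      (Filter.Eventually.of_forall (gaussianKernel_nonneg s)), integral_gaussianKernel hs,
    ENNReal.ofReal_one]

theorem planarGaussian_le_volume {s : ℝ} {S : Set ℂ} (hS : MeasurableSet S) :
    planarGaussian s S ≤ ENNReal.ofReal (2 * Real.pi * s ^ 2)⁻¹ * volume S := by
  rw [planarGaussian, withDensity_apply _ hS, ← setLIntegral_const]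
  exact lintegral_mono fun x => ENNReal.ofReal_le_ofReal (gaussianKernel_le s x)

/-- Half of the exponent bounds the tail, through `exp (-y) ≤ 1 / y`, and the other half is
integrated. Polynomial decay suffices for the smoothing. -/
theorem planarGaussian_tail_le {s ε : ℝ} (hs : 0 < s) (hε : 0 < ε) :
    (planarGaussian s).real {u : ℂ | ε ≤ ‖u‖} ≤ 8 * s ^ 2 / ε ^ 2 := by
  have hpi := Real.pi_pos
  have hS : MeasurableSet {u : ℂ | ε ≤ ‖u‖} := measurableSet_le measurable_const measurable_norm
  set b := 1 / (4 * s ^ 2) with hb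
  have hb0 : 0 < b := by positivity
  set K := (2 * Real.pi * s ^ 2)⁻¹ * Real.exp (-b * ε ^ 2) with hK
  have h1 : planarGaussian s {u : ℂ | ε ≤ ‖u‖}
      ≤ ∫⁻ u : ℂ, ENNReal.ofReal (K * Real.exp (-b * ‖u‖ ^ 2)) := by
    rw [planarGaussian, withDensity_apply _ hS]
    refine (setLIntegral_mono' hS fun u hu => ENNReal.ofReal_le_ofReal ?_).trans
      (setLIntegral_le_lintegral _ _)
    rw [hK, gaussianKernel, mul_assoc _ (Real.exp _), ← Real.exp_add]
    gcongr
    have h2 : -(1 / (2 * s ^ 2)) = -b - b := by rw [hb]; field_simp; norm_num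
    have h3 : ε ^ 2 ≤ ‖u‖ ^ 2 := by gcongr; exact hu
    rw [h2]; nlinarith
  rw [← ofReal_integral_eq_lintegral_ofReal ((integrable_exp_neg_mul_sq_norm hb0).const_mul _)
    (Filter.Eventually.of_forall fun u => by positivity), integral_const_mul,
    integral_exp_neg_mul_sq_norm hb0] at h1
  refine (ENNReal.toReal_le_of_le_ofReal (by positivity) h1).trans ?_
  have h4 : Real.exp (-b * ε ^ 2) ≤ 1 / (b * ε ^ 2) := by
    rw [neg_mul, Real.exp_neg, ← one_div]
    apply one_div_le_one_div_of_le (by positivity)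
    linarith [Real.add_one_le_exp (b * ε ^ 2)]
  calc K * (Real.pi / b) ≤ (2 * Real.pi * s ^ 2)⁻¹ * (1 / (b * ε ^ 2)) * (Real.pi / b) := by
        rw [hK]; gcongr
    _ = 8 * s ^ 2 / ε ^ 2 := by rw [hb]; field_simp; norm_num

theorem integrable_exp_mul_cexp_inner {s : ℝ} (hs : 0 < s) (x : ℂ) (c : ℂ) :
    Integrable fun ξ : ℂ => Complex.exp (-((s ^ 2 / 2 : ℝ) : ℂ) * ‖ξ‖ ^ 2
      + c * (inner ℝ x ξ : ℝ)) :=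
  GaussianFourier.integrable_cexp_neg_mul_sq_norm_add (V := ℂ) (b := ((s ^ 2 / 2 : ℝ) : ℂ))
    (by rw [Complex.ofReal_re]; positivity) c x

theorem gaussianKernel_eq_integral {s : ℝ} (hs : 0 < s) (x : ℂ) :
    (gaussianKernel s x : ℂ) = ((4 * Real.pi ^ 2)⁻¹ : ℝ) *
      ∫ ξ : ℂ, Complex.exp (-((s ^ 2 / 2 : ℝ) : ℂ) * ‖ξ‖ ^ 2
        + (-Complex.I) * (inner ℝ x ξ : ℝ)) := by
  have hpi := Real.pi_pos
  have h := GaussianFourier.integral_cexp_neg_mul_sq_norm_add (V := ℂ)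
    (b := ((s ^ 2 / 2 : ℝ) : ℂ)) (by rw [Complex.ofReal_re]; positivity) (-Complex.I) x
  rw [Complex.finrank_real_complex] at h
  rw [h, gaussianKernel]
  have hs' : (s : ℂ) ≠ 0 := by exact_mod_cast hs.ne'
  have hpi' : (Real.pi : ℂ) ≠ 0 := by exact_mod_cast hpi.ne'
  push_cast
  rw [div_self (by norm_num : (2 : ℂ) ≠ 0), Complex.cpow_one, ← mul_assoc]
  congr 1
  · field_simp; norm_num
  · congr 1
    rw [neg_sq, Complex.I_sq]
    field_simp
    ring

theorem charFun_planarGaussian {s : ℝ} (hs : 0 < s) (t : ℂ) :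
    charFun (planarGaussian s) t = Complex.exp (-(s ^ 2 * ‖t‖ ^ 2 / 2 : ℝ)) := by
  have hpi := Real.pi_pos
  have hs' : (s : ℂ) ≠ 0 := by exact_mod_cast hs.ne'
  have hpi' : (Real.pi : ℂ) ≠ 0 := by exact_mod_cast hpi.ne'
  rw [charFun_apply, planarGaussian, integral_withDensity_eq_integral_toReal_smul
    (by fun_prop) (Filter.Eventually.of_forall fun x => ENNReal.ofReal_lt_top)]
  have h := GaussianFourier.integral_cexp_neg_mul_sq_norm_add (V := ℂ)
    (b := ((1 / (2 * s ^ 2) : ℝ) : ℂ)) (by rw [Complex.ofReal_re]; positivity) (Complex.I) t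
  rw [Complex.finrank_real_complex] at h
  have h2 : ∀ x : ℂ, (ENNReal.ofReal (gaussianKernel s x)).toReal
      • Complex.exp ((inner ℝ x t : ℝ) * Complex.I)
      = ((2 * Real.pi * s ^ 2)⁻¹ : ℝ) * Complex.exp (-((1 / (2 * s ^ 2) : ℝ) : ℂ) * ‖x‖ ^ 2
        + Complex.I * (inner ℝ t x : ℝ)) := fun x => by
    rw [ENNReal.toReal_ofReal (gaussianKernel_nonneg s x), gaussianKernel, Complex.real_smul,
      Complex.exp_add, real_inner_comm]
    push_cast
    ring_nf
  simp_rw [h2]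
  rw [integral_const_mul, h]
  push_cast
  rw [div_self (by norm_num : (2 : ℂ) ≠ 0), Complex.cpow_one, ← mul_assoc]
  have h3 : (2 * (Real.pi : ℂ) * s ^ 2)⁻¹ * ((Real.pi : ℂ) / (1 / (2 * (s : ℂ) ^ 2))) = 1 := by field_simp
  rw [h3, one_mul]
  congr 1
  rw [Complex.I_sq]
  field_simp
  norm_num

theorem map_smul_stdGaussian {s : ℝ} (hs : 0 < s) :
    (stdGaussian ℂ).map (fun z => s • z) = planarGaussian s := by
  have := isProbabilityMeasure_planarGaussian hs
  have : IsProbabilityMeasure ((stdGaussian ℂ).map (fun z => s • z)) :=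
    Measure.isProbabilityMeasure_map (by fun_prop)
  refine Measure.ext_of_charFun (funext fun t => ?_)
  rw [charFun_map_smul, charFun_stdGaussian, charFun_planarGaussian hs, norm_smul,
    Real.norm_of_nonneg hs.le]
  push_cast
  ring_nf

/-- Fourier inversion for the density of a measure convolved with a Gaussian. -/
theorem integral_gaussianKernel_sub {s : ℝ} (hs : 0 < s) (ν : Measure ℂ) [IsProbabilityMeasure ν]
    (x : ℂ) :
    ((∫ y, gaussianKernel s (x - y) ∂ν : ℝ) : ℂ) = ((4 * Real.pi ^ 2)⁻¹ : ℝ) *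
      ∫ ξ : ℂ, Complex.exp (-((s ^ 2 / 2 : ℝ) : ℂ) * ‖ξ‖ ^ 2
        + (-Complex.I) * (inner ℝ x ξ : ℝ)) * charFun ν ξ := by
  rw [← integral_complex_ofReal]
  simp_rw [gaussianKernel_eq_integral hs]
  rw [integral_const_mul]
  congr 1
  have hsplit : ∀ y ξ : ℂ, Complex.exp (-((s ^ 2 / 2 : ℝ) : ℂ) * ‖ξ‖ ^ 2
        + (-Complex.I) * (inner ℝ (x - y) ξ : ℝ))
      = Complex.exp (-((s ^ 2 / 2 : ℝ) : ℂ) * ‖ξ‖ ^ 2 + (-Complex.I) * (inner ℝ x ξ : ℝ))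
        * Complex.exp ((inner ℝ y ξ : ℝ) * Complex.I) := fun y ξ => by
    rw [← Complex.exp_add, inner_sub_left]
    push_cast
    ring_nf
  rw [integral_integral_swap]
  · refine integral_congr_ae (Filter.Eventually.of_forall fun ξ => ?_)
    simp only [hsplit]
    rw [integral_const_mul, charFun_apply]
  · have h1 : Integrable (fun p : ℂ × ℂ => Complex.exp (-((s ^ 2 / 2 : ℝ) : ℂ) * ‖p.2‖ ^ 2
        + (-Complex.I) * (inner ℝ x p.2 : ℝ))) (ν.prod volume) :=
      (integrable_exp_mul_cexp_inner hs x _).comp_snd ν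
    refine h1.mono (Continuous.aestronglyMeasurable ?_) (Filter.Eventually.of_forall fun p => ?_)
    · unfold Function.uncurry; fun_prop
    · simp only [Function.uncurry]
      rw [hsplit, norm_mul, Complex.norm_exp_ofReal_mul_I, mul_one]

/-- Fourier inversion with absolute values inside; the prefactor `1 / (4 π ^ 2) ≤ 1` is dropped. -/
theorem abs_integral_gaussianKernel_sub_le {s : ℝ} (hs : 0 < s) (ν₁ ν₂ : Measure ℂ)
    [IsProbabilityMeasure ν₁] [IsProbabilityMeasure ν₂] {G : ℂ → ℝ} (hG : Integrable G)
    (h : ∀ ξ, Real.exp (-(s ^ 2 / 2) * ‖ξ‖ ^ 2) * ‖charFun ν₁ ξ - charFun ν₂ ξ‖ ≤ G ξ) (x : ℂ) :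
    |∫ y, gaussianKernel s (x - y) ∂ν₁ - ∫ y, gaussianKernel s (x - y) ∂ν₂| ≤ ∫ ξ, G ξ := by
  have hpi := Real.pi_gt_three
  have hint : ∀ (ν : Measure ℂ) [IsProbabilityMeasure ν],
      Integrable fun ξ : ℂ => Complex.exp (-((s ^ 2 / 2 : ℝ) : ℂ) * ‖ξ‖ ^ 2
        + (-Complex.I) * (inner ℝ x ξ : ℝ)) * charFun ν ξ := fun ν _ =>
    (integrable_exp_mul_cexp_inner hs x _).mul_bdd (c := 1) measurable_charFun.aestronglyMeasurable
      (Filter.Eventually.of_forall fun ξ => norm_charFun_le_one ξ)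
  rw [← Real.norm_eq_abs, ← Complex.norm_real, Complex.ofReal_sub,
    integral_gaussianKernel_sub hs ν₁, integral_gaussianKernel_sub hs ν₂, ← mul_sub,
    ← integral_sub (hint ν₁) (hint ν₂), norm_mul, Complex.norm_real,
    Real.norm_of_nonneg (by positivity)]
  refine (mul_le_of_le_one_left (norm_nonneg _) (inv_le_one_of_one_le₀ (by nlinarith))).trans ?_
  refine norm_integral_le_of_norm_le hG (Filter.Eventually.of_forall fun ξ => ?_)
  refine le_trans (le_of_eq ?_) (h ξ)
  rw [← mul_sub, norm_mul, Complex.norm_exp]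
  congr 2
  simp [← Complex.ofReal_pow]

theorem volume_ball_eq (x : ℂ) {R : ℝ} (hR : 0 ≤ R) :
    volume (Metric.ball x R) = ENNReal.ofReal (Real.pi * R ^ 2) := by
  rw [Complex.volume_ball, ENNReal.ofReal_mul Real.pi_pos.le, ← ENNReal.ofReal_pow hR, mul_comm]
  congr 1
  rw [← NNReal.coe_real_pi, ENNReal.ofReal_coe_nnreal]

/-- A Gaussian convolution, through its density. -/
theorem conv_planarGaussian_apply {s : ℝ} (ν : Measure ℂ)
    [IsProbabilityMeasure ν] {B : Set ℂ} (hB : MeasurableSet B) :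
    (ν ∗ planarGaussian s) B
      = ∫⁻ x in B, ENNReal.ofReal (∫ y, gaussianKernel s (x - y) ∂ν) := by
  have hk : Measurable fun x => ENNReal.ofReal (gaussianKernel s x) := by fun_prop
  have hind : Measurable (B.indicator (1 : ℂ → ℝ≥0∞)) := measurable_one.indicator hB
  have : SFinite (planarGaussian s) := by unfold planarGaussian; infer_instance
  rw [← lintegral_indicator_one hB, Measure.lintegral_conv hind]
  have h1 : ∀ y, ∫⁻ u, B.indicator 1 (y + u) ∂(planarGaussian s)
      = ∫⁻ x, ENNReal.ofReal (gaussianKernel s (x - y)) * B.indicator 1 x := fun y => by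
    have hcomp : Measurable fun u => B.indicator (1 : ℂ → ℝ≥0∞) (y + u) :=
      hind.comp (measurable_const_add y)
    rw [planarGaussian, lintegral_withDensity_eq_lintegral_mul _ hk hcomp,
      ← lintegral_sub_right_eq_self _ y]
    refine lintegral_congr fun x => ?_
    simp
  simp_rw [h1]
  rw [lintegral_lintegral_swap, ← lintegral_indicator hB]
  · refine lintegral_congr fun x => ?_
    by_cases hx : x ∈ B
    · simp only [Set.indicator_of_mem hx, Pi.one_apply, mul_one]
      rw [ofReal_integral_eq_lintegral_ofReal]
      · refine Integrable.of_bound (C := (2 * Real.pi * s ^ 2)⁻¹)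
          (Continuous.aestronglyMeasurable (by fun_prop)) (Filter.Eventually.of_forall fun y => ?_)
        rw [Real.norm_of_nonneg (gaussianKernel_nonneg _ _)]
        exact gaussianKernel_le _ _
      · exact Filter.Eventually.of_forall fun y => gaussianKernel_nonneg _ _
    · simp [Set.indicator_of_notMem hx]
  · refine Measurable.aemeasurable ?_
    unfold Function.uncurry
    exact (hk.comp (measurable_snd.sub measurable_fst)).mul (hind.comp measurable_snd)

theorem conv_planarGaussian_le {s D : ℝ} (hD : 0 ≤ D) (ν₁ ν₂ : Measure ℂ)
    [IsProbabilityMeasure ν₁] [IsProbabilityMeasure ν₂]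
    (h : ∀ x, |∫ y, gaussianKernel s (x - y) ∂ν₁ - ∫ y, gaussianKernel s (x - y) ∂ν₂| ≤ D)
    {B : Set ℂ} (hB : MeasurableSet B) :
    (ν₁ ∗ planarGaussian s) B ≤ (ν₂ ∗ planarGaussian s) B + ENNReal.ofReal D * volume B := by
  rw [conv_planarGaussian_apply ν₁ hB, conv_planarGaussian_apply ν₂ hB, ← setLIntegral_const,
    ← lintegral_add_right _ measurable_const]
  refine lintegral_mono fun x => ?_
  rw [← ENNReal.ofReal_add (integral_nonneg fun y => gaussianKernel_nonneg _ _) hD]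
  exact ENNReal.ofReal_le_ofReal (by linarith [(abs_le.1 (h x)).2])

/-! ### Removing the smoothing on discs -/

section Smoothing

variable (ν γ : Measure ℂ) [IsProbabilityMeasure ν] [IsProbabilityMeasure γ]

theorem ball_mul_le_conv (x : ℂ) (R ε : ℝ) :
    ν.real (Metric.ball x R) * (1 - γ.real {u | ε ≤ ‖u‖}) ≤ (ν ∗ γ).real (Metric.ball x (R + ε)) := by
  have hS : MeasurableSet {u : ℂ | ε ≤ ‖u‖} := measurableSet_le measurable_const measurable_norm
  rw [← probReal_compl_eq_one_sub hS, ← measureReal_prod_prod, Measure.conv,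
    map_measureReal_apply (by fun_prop) Metric.isOpen_ball.measurableSet]
  refine measureReal_mono fun p hp => ?_
  obtain ⟨h1, h2⟩ := hp
  rw [Metric.mem_ball, dist_eq_norm] at h1
  simp only [Set.mem_compl_iff, Set.mem_ofPred_eq, not_le] at h2
  rw [Set.mem_preimage, Metric.mem_ball, dist_eq_norm]
  calc ‖p.1 + p.2 - x‖ = ‖(p.1 - x) + p.2‖ := by ring_nf
    _ ≤ _ := norm_add_le _ _
    _ < _ := by linarith

/-- A large displacement by `γ` still has to land in the disc, so conditionally on it the mass is at
most `m`. Without the factor `m` the tail would not scale like `r ^ 2`. -/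
theorem conv_le_ball_add (x : ℂ) {R ε m : ℝ} (hm : ∀ y, ν.real (Metric.ball y R) ≤ m) :
    (ν ∗ γ).real (Metric.ball x R)
      ≤ ν.real (Metric.ball x (R + ε)) + γ.real {u | ε ≤ ‖u‖} * m := by
  have hm0 : 0 ≤ m := measureReal_nonneg.trans (hm 0)
  have hS : MeasurableSet {u : ℂ | ε ≤ ‖u‖} := measurableSet_le measurable_const measurable_norm
  rw [Measure.conv, map_measureReal_apply (by fun_prop) Metric.isOpen_ball.measurableSet]
  set T : Set (ℂ × ℂ) := {p | ε ≤ ‖p.2‖ ∧ p.1 + p.2 ∈ Metric.ball x R} with hT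
  have hTm : MeasurableSet T := (measurable_snd hS).inter
    ((measurable_fst.add measurable_snd) Metric.isOpen_ball.measurableSet)
  have h1 : (fun p : ℂ × ℂ => p.1 + p.2) ⁻¹' Metric.ball x R
      ⊆ (Metric.ball x (R + ε) ×ˢ Set.univ) ∪ T := fun p hp => by
    by_cases hε : ε ≤ ‖p.2‖
    · exact Or.inr ⟨hε, hp⟩
    · refine Or.inl ⟨?_, trivial⟩
      rw [Set.mem_preimage, Metric.mem_ball, dist_eq_norm] at hp
      rw [Metric.mem_ball, dist_eq_norm]
      calc ‖p.1 - x‖ = ‖(p.1 + p.2 - x) - p.2‖ := by ring_nf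
        _ ≤ _ := norm_sub_le _ _
        _ < _ := by linarith
  refine (measureReal_mono h1).trans ((measureReal_union_le _ _).trans ?_)
  rw [measureReal_prod_prod, probReal_univ, mul_one]
  gcongr
  have h2 : (ν.prod γ) T ≤ γ {u | ε ≤ ‖u‖} * ENNReal.ofReal m := by
    rw [Measure.prod_apply_symm hTm, mul_comm, ← setLIntegral_const, ← lintegral_indicator hS]
    refine lintegral_mono fun u => ?_
    by_cases hu : ε ≤ ‖u‖
    · rw [Set.indicator_of_mem (show u ∈ {u : ℂ | ε ≤ ‖u‖} from hu)]
      refine (measure_mono (t := Metric.ball (x - u) R) fun y hy => ?_).trans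
        ((ENNReal.le_ofReal_iff_toReal_le (measure_ne_top _ _) hm0).2 (hm (x - u)))
      have := hy.2
      rw [Metric.mem_ball, dist_eq_norm] at this ⊢
      convert this using 2
      ring
    · have : (fun y => (y, u)) ⁻¹' T = ∅ := by
        ext y; simp [hT, hu]
      rw [this]; simp
  rw [measureReal_def, measureReal_def, ← ENNReal.toReal_ofReal hm0, ← ENNReal.toReal_mul]
  exact ENNReal.toReal_mono (ENNReal.mul_ne_top (measure_ne_top _ _) ENNReal.ofReal_ne_top) h2

end Smoothing

theorem annulus_le {ν : Measure ℂ} [IsProbabilityMeasure ν] {M : ℝ} (hM : 0 ≤ M)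
    (h : ∀ S, MeasurableSet S → ν S ≤ ENNReal.ofReal M * volume S) (x : ℂ) {R R' : ℝ}
    (hR : 0 ≤ R) (hRR' : R ≤ R') :
    ν.real (Metric.ball x R') ≤ ν.real (Metric.ball x R) + M * (Real.pi * (R' ^ 2 - R ^ 2)) := by
  have hpi := Real.pi_pos
  have hsub : Metric.ball x R ⊆ Metric.ball x R' := Metric.ball_subset_ball hRR'
  have hm : MeasurableSet (Metric.ball x R) := Metric.isOpen_ball.measurableSet
  have hm' : MeasurableSet (Metric.ball x R') := Metric.isOpen_ball.measurableSet
  have h1 : ν.real (Metric.ball x R' \ Metric.ball x R) ≤ M * (Real.pi * (R' ^ 2 - R ^ 2)) := by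
    have hsq : R ^ 2 ≤ R' ^ 2 := by gcongr
    refine ENNReal.toReal_le_of_le_ofReal (by nlinarith [mul_nonneg hM hpi.le]) ?_
    refine (h _ (hm'.diff hm)).trans (le_of_eq ?_)
    rw [measure_sdiff hsub hm.nullMeasurableSet measure_ball_lt_top.ne, volume_ball_eq x hR,
      volume_ball_eq x (hR.trans hRR'), ← ENNReal.ofReal_sub _ (by positivity),
      ← ENNReal.ofReal_mul hM]
    congr 1; ring
  rw [measureReal_sdiff hsub hm] at h1
  linarith

/-- If two probability measures become close on discs after convolution with `γ`, then they are
close on discs, provided that one of them has bounded density and `γ` is concentrated near `0`. -/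
theorem abs_ball_sub_ball_le {ν₁ ν₂ γ : Measure ℂ} [IsProbabilityMeasure ν₁]
    [IsProbabilityMeasure ν₂] [IsProbabilityMeasure γ] {M D δ η r : ℝ} (hM : 0 ≤ M) (hD : 0 ≤ D)
    (hr : 0 < r) (hδ : 0 ≤ δ) (hδ1 : δ ≤ 1 / 2) (hη1 : η ≤ 1 / 2)
    (hγ : γ.real {u | δ * r ≤ ‖u‖} ≤ η)
    (hν : ∀ S, MeasurableSet S → ν₂ S ≤ ENNReal.ofReal M * volume S)
    (h₁₂ : ∀ (x : ℂ) (R : ℝ), 0 ≤ R →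
      (ν₁ ∗ γ).real (Metric.ball x R) ≤ (ν₂ ∗ γ).real (Metric.ball x R) + D * (Real.pi * R ^ 2))
    (h₂₁ : ∀ (x : ℂ) (R : ℝ), 0 ≤ R →
      (ν₂ ∗ γ).real (Metric.ball x R) ≤ (ν₁ ∗ γ).real (Metric.ball x R) + D * (Real.pi * R ^ 2))
    (x : ℂ) :
    |ν₁.real (Metric.ball x r) - ν₂.real (Metric.ball x r)|
      ≤ Real.pi * r ^ 2 * (15 * η * M + 6 * δ * M + 6 * D) := by
  set η₀ := γ.real {u | δ * r ≤ ‖u‖} with hη₀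
  have hη₀0 : 0 ≤ η₀ := measureReal_nonneg
  set V := Real.pi * r ^ 2 with hV
  have hV0 : 0 < V := by have := Real.pi_pos; positivity
  have hball : ∀ (y : ℂ) (k : ℝ), 0 ≤ k → ν₂.real (Metric.ball y (k * r)) ≤ M * V * k ^ 2 :=
    fun y k hk => by
      have := annulus_le hM hν y le_rfl (mul_nonneg hk hr.le)
      simp only [Metric.ball_zero, measureReal_empty] at this
      calc _ ≤ _ := this
        _ = _ := by rw [hV]; ring
  have hMV : 0 ≤ M * V := by positivity
  have hDV : 0 ≤ D * V := by positivity
  have up : ∀ y, ν₁.real (Metric.ball y r) * (1 - η₀)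
      ≤ ν₂.real (Metric.ball y r) + M * V * (6 * δ) + η₀ * (M * V * 3) + D * V * 3 := fun y => by
    have a1 := ball_mul_le_conv ν₁ γ y r (δ * r)
    have a2 := h₁₂ y (r + δ * r) (by positivity)
    have a3 := conv_le_ball_add ν₂ γ y (R := r + δ * r) (ε := δ * r) (m := M * V * 3)
      (fun z => by
        have := hball z (1 + δ) (by linarith)
        rw [show r + δ * r = (1 + δ) * r by ring]
        refine this.trans ?_
        gcongr
        nlinarith)
    have a4 := annulus_le hM hν y hr.le (R' := r + δ * r + δ * r) (by nlinarith)
    have a5 : M * (Real.pi * ((r + δ * r + δ * r) ^ 2 - r ^ 2)) ≤ M * V * (6 * δ) := by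
      rw [show M * (Real.pi * ((r + δ * r + δ * r) ^ 2 - r ^ 2)) = M * V * (4 * δ + 4 * δ ^ 2) by
        rw [hV]; ring]
      gcongr
      nlinarith
    have a6 : D * (Real.pi * (r + δ * r) ^ 2) ≤ D * V * 3 := by
      rw [show D * (Real.pi * (r + δ * r) ^ 2) = D * V * (1 + δ) ^ 2 by rw [hV]; ring]
      gcongr
      nlinarith
    linarith
  -- A first bound on `ν₁` of order `r ^ 2`, as `ν₁` has no density. It is fed back into the tail
  -- terms, so that they carry both `η` and `r ^ 2`.
  have crude : ∀ y, ν₁.real (Metric.ball y r) ≤ 12 * (M * V) + 6 * (D * V) := fun y => by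
    have b1 := up y
    have b2 := hball y 1 zero_le_one
    rw [one_mul] at b2
    have b3 : ν₁.real (Metric.ball y r) * (1 / 2) ≤ ν₁.real (Metric.ball y r) * (1 - η₀) := by
      gcongr; linarith
    have b4 : M * V * (6 * δ) ≤ M * V * 3 := by gcongr; linarith
    have b5 : η₀ * (M * V * 3) ≤ 1 / 2 * (M * V * 3) := by gcongr; linarith
    linarith
  have c1 : ν₁.real (Metric.ball x r) * η₀ ≤ η * (12 * (M * V)) + 1 / 2 * (6 * (D * V)) := by
    have d1 : ν₁.real (Metric.ball x r) * η₀ ≤ (12 * (M * V) + 6 * (D * V)) * η₀ := by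
      gcongr; exact crude x
    have d2 : η₀ * (12 * (M * V)) ≤ η * (12 * (M * V)) := by gcongr
    have d3 : η₀ * (6 * (D * V)) ≤ 1 / 2 * (6 * (D * V)) := by gcongr; linarith
    linarith
  have hηMV : η₀ * (M * V) ≤ η * (M * V) := by gcongr
  have hηMV0 : 0 ≤ η * (M * V) := (mul_nonneg hη₀0 hMV).trans hηMV
  rw [abs_le]
  constructor
  -- For the lower bound, start from the disc of radius `(1 - 2 δ) r`: smoothing and then
  -- unsmoothing each enlarge the radius by `δ r`.
  · have a0 : 0 ≤ (1 - 2 * δ) * r := mul_nonneg (by linarith) hr.le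
    have a1 := annulus_le hM hν x a0 (R' := r) (by nlinarith)
    have a2 : M * (Real.pi * (r ^ 2 - ((1 - 2 * δ) * r) ^ 2)) ≤ M * V * (4 * δ) := by
      rw [show M * (Real.pi * (r ^ 2 - ((1 - 2 * δ) * r) ^ 2)) = M * V * (4 * δ - 4 * δ ^ 2) by
        rw [hV]; ring]
      gcongr
      nlinarith
    have a3 := ball_mul_le_conv ν₂ γ x ((1 - 2 * δ) * r) (δ * r)
    rw [show (1 - 2 * δ) * r + δ * r = (1 - δ) * r by ring, ← hη₀] at a3
    have a4 : ν₂.real (Metric.ball x ((1 - 2 * δ) * r)) * η₀ ≤ M * V * η₀ := by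
      gcongr
      refine (hball x (1 - 2 * δ) (by linarith)).trans (mul_le_of_le_one_right hMV ?_)
      nlinarith
    have a5 := h₂₁ x ((1 - δ) * r) (mul_nonneg (by linarith) hr.le)
    have a6 : D * (Real.pi * ((1 - δ) * r) ^ 2) ≤ D * V := by
      rw [show D * (Real.pi * ((1 - δ) * r) ^ 2) = D * V * (1 - δ) ^ 2 by rw [hV]; ring]
      exact mul_le_of_le_one_right hDV (by nlinarith)
    have a7 := conv_le_ball_add ν₁ γ x (R := (1 - δ) * r) (ε := δ * r)
      (m := 12 * (M * V) + 6 * (D * V)) (fun z =>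
        (measureReal_mono (Metric.ball_subset_ball (by nlinarith))).trans (crude z))
    rw [show (1 - δ) * r + δ * r = r by ring, ← hη₀] at a7
    have a8 : η₀ * (6 * (D * V)) ≤ 1 / 2 * (6 * (D * V)) := by gcongr; linarith
    have a9 : 0 ≤ M * V * δ := by positivity
    linarith
  · have := up x
    linarith

/-! ### Random isometries and the recursion for the walk -/

theorem measurable_apply (x : ℂ) : Measurable fun h : ℂ ≃ᵢ ℂ => h x :=
  (measurable_pi_apply x).comp (comap_measurable _)

theorem measurable_eval : Measurable fun p : (ℂ ≃ᵢ ℂ) × ℂ => p.1 p.2 :=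
  (measurable_uncurry_of_continuous_of_measurable (u := fun (x : ℂ) (h : ℂ ≃ᵢ ℂ) => h x)
    (fun h => h.continuous) measurable_apply).comp measurable_swap

/-- An isometry is determined by its values on a countable dense set. -/
instance instMeasurableSingletonClassIsom : MeasurableSingletonClass (ℂ ≃ᵢ ℂ) := by
  refine ⟨fun h => ?_⟩
  have : {h} = ⋂ n : ℕ, {k : ℂ ≃ᵢ ℂ | k (TopologicalSpace.denseSeq ℂ n)
      = h (TopologicalSpace.denseSeq ℂ n)} := by
    ext k
    simp only [Set.mem_singleton_iff, Set.mem_iInter, Set.mem_ofPred_eq]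
    refine ⟨fun e n => by rw [e], fun e => DFunLike.coe_injective ?_⟩
    refine Continuous.ext_on (TopologicalSpace.denseRange_denseSeq ℂ) k.continuous h.continuous ?_
    rintro _ ⟨n, rfl⟩
    exact e n
  rw [this]
  exact MeasurableSet.iInter fun n => measurable_apply _ (measurableSet_singleton _)

theorem toMeasure_eq_sum {α : Type*} [MeasurableSpace α] (μ : PMF α) (S : Finset α)
    (hS : μ.support ⊆ S) : μ.toMeasure = ∑ a ∈ S, μ a • Measure.dirac a := by
  ext T hT
  rw [PMF.toMeasure_apply _ hT, tsum_eq_sum (s := S)]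
  · simp only [Measure.coe_finsetSum, Finset.sum_apply, Measure.smul_apply, smul_eq_mul,
      Measure.dirac_apply' _ hT]
    refine Finset.sum_congr rfl fun a _ => ?_
    by_cases ha : a ∈ T <;> simp [ha]
  · intro a ha
    have : μ a = 0 := by
      rw [PMF.apply_eq_zero_iff]
      exact fun h => ha (hS h)
    by_cases h : a ∈ T <;> simp [h, this]

theorem integral_toMeasure {α E : Type*} [MeasurableSpace α] [MeasurableSingletonClass α]
    [NormedAddCommGroup E] [NormedSpace ℝ E] [CompleteSpace E] (μ : PMF α) (S : Finset α)
    (hS : μ.support ⊆ S) (f : α → E) :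
    ∫ a, f a ∂μ.toMeasure = ∑ a ∈ S, (μ a).toReal • f a := by
  rw [toMeasure_eq_sum μ S hS, integral_finsetSum_measure]
  · simp
  · intro a _
    exact (integrable_dirac (by simp)).smul_measure (μ.apply_ne_top a)

section Walk

variable {Ω : Type*} [MeasurableSpace Ω] {P : Measure Ω} {g : ℕ → Ω → (ℂ ≃ᵢ ℂ)}
  {μ : PMF (ℂ ≃ᵢ ℂ)}

theorem walk_zero {Ω : Type*} (g : ℕ → Ω → (ℂ ≃ᵢ ℂ)) : walk g 0 = fun _ => 0 := by
  funext ω; simp [walk]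

theorem walk_succ {Ω : Type*} (g : ℕ → Ω → (ℂ ≃ᵢ ℂ)) (N : ℕ) (ω : Ω) :
    walk g (N + 1) ω = g 0 ω (walk (fun j => g (j + 1)) N ω) := by
  simp [walk, List.ofFn_succ]

theorem measurable_walk (hg : ∀ j, Measurable (g j)) (N : ℕ) : Measurable (walk g N) := by
  induction N generalizing g with
  | zero => rw [walk_zero]; exact measurable_const
  | succ N ih =>
    have : walk g (N + 1) = fun ω => g 0 ω (walk (fun j => g (j + 1)) N ω) :=
      funext fun ω => walk_succ g N ω
    rw [this]
    exact measurable_eval.comp ((hg 0).prodMk (ih fun j => hg (j + 1)))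

theorem aemeasurable_walk (hg : ∀ j, AEMeasurable (g j) P) (N : ℕ) : AEMeasurable (walk g N) P := by
  induction N generalizing g with
  | zero => rw [walk_zero]; exact aemeasurable_const
  | succ N ih =>
    have : walk g (N + 1) = fun ω => g 0 ω (walk (fun j => g (j + 1)) N ω) :=
      funext fun ω => walk_succ g N ω
    rw [this]
    exact measurable_eval.comp_aemeasurable ((hg 0).prodMk (ih fun j => hg (j + 1)))

theorem IsIIDSample.shift (h : IsIIDSample P g μ) : IsIIDSample P (fun j => g (j + 1)) μ :=
  ⟨fun j => h.hasLaw (j + 1), h.indep.precomp (add_left_injective 1)⟩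

theorem IsIIDSample.aemeasurable (h : IsIIDSample P g μ) (j : ℕ) : AEMeasurable (g j) P :=
  (h.hasLaw j).aemeasurable

theorem IsIIDSample.indepFun_walk [IsProbabilityMeasure P] (h : IsIIDSample P g μ) (N : ℕ) :
    IndepFun (g 0) (walk (fun j => g (j + 1)) N) P := by
  set T : Finset ℕ := Finset.Icc 1 N
  have h1 := h.indep.indepFun_finset₀ {0} T (by simp [T]) h.aemeasurable
  -- Expresses the shifted walk as a function of the factors indexed by `T`. The default `1` is
  -- never read, since the first `N` shifted indices lie in `T`.
  set k : ℕ → ((i : T) → (ℂ ≃ᵢ ℂ)) → (ℂ ≃ᵢ ℂ) := fun j a =>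
    if hj : j + 1 ∈ T then a ⟨j + 1, hj⟩ else 1 with hk
  have hkm : ∀ j, Measurable (k j) := fun j => by
    by_cases hj : j + 1 ∈ T
    · simp only [hk, hj, dite_true]; exact measurable_pi_apply _
    · simp only [hk, hj, dite_false]; exact measurable_const
  have h2 := h1.comp (measurable_pi_apply (⟨0, by simp⟩ : ({0} : Finset ℕ))) (measurable_walk hkm N)
  have hwalk : walk (fun j => g (j + 1)) N = walk k N ∘ fun ω (i : T) => g i ω := by
    funext ω
    simp only [Function.comp_apply, walk]
    congr 2
    refine List.ofFn_inj.2 (funext fun j => ?_)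
    have : (j : ℕ) + 1 ∈ T := Finset.mem_Icc.2 ⟨by omega, by omega⟩
    simp only [hk, this, dite_true]
  rw [hwalk]
  exact h2

/-- Independence makes the joint law of the outermost factor and the remaining walk a product, and
Fubini applies. -/
theorem IsIIDSample.charFun_map_walk_succ [IsProbabilityMeasure P] (h : IsIIDSample P g μ) (N : ℕ)
    (ξ : ℂ) :
    charFun (P.map (walk g (N + 1))) ξ = ∫ k, (∫ y, Complex.exp ((inner ℝ (k y) ξ : ℝ) * Complex.I)
      ∂(P.map (walk (fun j => g (j + 1)) N))) ∂μ.toMeasure := by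
  have hY := aemeasurable_walk h.shift.aemeasurable N
  have hprob : IsProbabilityMeasure (P.map (walk (fun j => g (j + 1)) N)) :=
    Measure.isProbabilityMeasure_map hY
  have hlaw := (indepFun_iff_map_prod_eq_prod_map_map (h.aemeasurable 0) hY).1 (h.indepFun_walk N)
  rw [(h.hasLaw 0).map_eq] at hlaw
  have hw : walk g (N + 1) = fun ω => g 0 ω (walk (fun j => g (j + 1)) N ω) :=
    funext fun ω => walk_succ g N ω
  have hc : Measurable fun p : (ℂ ≃ᵢ ℂ) × ℂ => Complex.exp ((inner ℝ (p.1 p.2) ξ : ℝ) * Complex.I) := by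
    have : Measurable fun y : ℂ => Complex.exp ((inner ℝ y ξ : ℝ) * Complex.I) := by fun_prop
    exact this.comp measurable_eval
  rw [charFun_apply, integral_map (aemeasurable_walk h.aemeasurable _)
    (Measurable.aestronglyMeasurable (by fun_prop)), hw]
  rw [← integral_prod (fun p : (ℂ ≃ᵢ ℂ) × ℂ => Complex.exp ((inner ℝ (p.1 p.2) ξ : ℝ) * Complex.I)),
    ← hlaw, integral_map ((h.aemeasurable 0).prodMk hY) hc.aestronglyMeasurable]
  refine Integrable.of_bound hc.aestronglyMeasurable 1 (Filter.Eventually.of_forall fun p => ?_)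
  rw [Complex.norm_exp_ofReal_mul_I]

/-- The distribution `μ` of a random isometry acts on characteristic functions as the transfer
operator of `W` and `u`. -/
def HasTransfer (μ : PMF (ℂ ≃ᵢ ℂ)) (W : StepWeights) (u : ℂ) : Prop :=
  ∀ (ν : Measure ℂ) [IsProbabilityMeasure ν] (F : ℂ → ℝ), (∀ ξ, charFun ν ξ = F ξ) →
    ∀ ξ : ℂ, ∫ k, (∫ y, Complex.exp ((inner ℝ (k y) ξ : ℝ) * Complex.I) ∂ν) ∂μ.toMeasure
      = W.transfer u F ξ

theorem IsIIDSample.charFun_map_walk [IsProbabilityMeasure P] (h : IsIIDSample P g μ)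
    {W : StepWeights} {u : ℂ} (hμ : HasTransfer μ W u) (N : ℕ) (ξ : ℂ) :
    charFun (P.map (walk g N)) ξ = W.char u N ξ := by
  induction N generalizing g ξ with
  | zero =>
    rw [walk_zero, Measure.map_const]
    simp [StepWeights.char, charFun_dirac]
  | succ N ih =>
    have hprob : IsProbabilityMeasure (P.map (walk (fun j => g (j + 1)) N)) :=
      Measure.isProbabilityMeasure_map (aemeasurable_walk h.shift.aemeasurable N)
    rw [h.charFun_map_walk_succ]
    exact hμ _ _ (fun ζ => ih h.shift ζ) ξ

end Walk

/-! ### The two kinds of step distribution -/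

theorem inner_mul_left_complex (z y ξ : ℂ) : (inner ℝ (z * y) ξ : ℝ) = inner ℝ y (conj z * ξ) := by
  simp only [Complex.inner, map_mul]
  congr 1; ring

theorem ρ_apply (θ : ℝ) (y : ℂ) : ρ θ y = Complex.exp (θ * Complex.I) * y := by
  simp [ρ, rotation_apply, Circle.coe_exp]

theorem τ_apply (v y : ℂ) : τ v y = y + v := rfl

theorem conj_exp_mul_I (θ : ℝ) :
    conj (Complex.exp (θ * Complex.I)) = Complex.exp ((-θ : ℝ) * Complex.I) := by
  rw [← Complex.exp_conj]; simp

theorem integral_exp_ρ (ν : Measure ℂ) (θ : ℝ) (ξ : ℂ) :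
    ∫ y, Complex.exp ((inner ℝ (ρ θ y) ξ : ℝ) * Complex.I) ∂ν
      = charFun ν (Complex.exp ((-θ : ℝ) * Complex.I) * ξ) := by
  simp_rw [charFun_apply, ρ_apply, inner_mul_left_complex, conj_exp_mul_I]

theorem integral_exp_τ_mul (ν : Measure ℂ) (v : ℂ) (k : ℂ ≃ᵢ ℂ) (ξ : ℂ) :
    ∫ y, Complex.exp ((inner ℝ ((τ v * k) y) ξ : ℝ) * Complex.I) ∂ν
      = Complex.exp ((inner ℝ v ξ : ℝ) * Complex.I)
        * ∫ y, Complex.exp ((inner ℝ (k y) ξ : ℝ) * Complex.I) ∂ν := by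
  rw [← integral_const_mul]
  refine integral_congr_ae (Filter.Eventually.of_forall fun y => ?_)
  simp only [IsometryEquiv.mul_apply, τ_apply]
  rw [← Complex.exp_add, inner_add_left]
  push_cast; ring_nf

theorem integral_exp_τ (ν : Measure ℂ) (v ξ : ℂ) :
    ∫ y, Complex.exp ((inner ℝ (τ v y) ξ : ℝ) * Complex.I) ∂ν
      = Complex.exp ((inner ℝ v ξ : ℝ) * Complex.I) * charFun ν ξ := by
  have := integral_exp_τ_mul ν v 1 ξ
  simpa [charFun_apply] using this

theorem exp_inner_one_add (ξ : ℂ) :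
    Complex.exp ((inner ℝ (1 : ℂ) ξ : ℝ) * Complex.I)
      + Complex.exp ((inner ℝ (-1 : ℂ) ξ : ℝ) * Complex.I) = 2 * (Real.cos ξ.re : ℝ) := by
  rw [inner_neg_left]
  simp only [Complex.inner, map_one, mul_one]
  push_cast
  rw [Complex.two_cos]

theorem ρ_zero (θ : ℝ) : ρ θ 0 = 0 := by simp [ρ_apply]

theorem τ_zero (v : ℂ) : τ v 0 = v := by simp [τ_apply]

theorem τ_one_ne_τ_neg_one : τ 1 ≠ τ (-1) := fun h => by
  have := DFunLike.congr_fun h 0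
  rw [τ_zero, τ_zero] at this
  norm_num [Complex.ext_iff] at this

theorem ρ_ne_τ (θ : ℝ) {v : ℂ} (hv : v ≠ 0) : ρ θ ≠ τ v := fun h => by
  have := DFunLike.congr_fun h 0
  rw [ρ_zero, τ_zero] at this
  exact hv this.symm

open Classical in
theorem IsLittlewood.integral_eq {θ : ℝ} {μ : PMF (ℂ ≃ᵢ ℂ)} (h : IsLittlewood θ μ) {E : Type*}
    [NormedAddCommGroup E] [NormedSpace ℝ E] [CompleteSpace E] (f : (ℂ ≃ᵢ ℂ) → E) :
    ∫ k, f k ∂μ.toMeasure = (1 / 2 : ℝ) • f (τ 1 * ρ θ) + (1 / 2 : ℝ) • f (τ (-1) * ρ θ) := by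
  have hne : τ 1 * ρ θ ≠ τ (-1) * ρ θ := fun e => τ_one_ne_τ_neg_one (mul_right_cancel e)
  rw [integral_toMeasure μ {τ 1 * ρ θ, τ (-1) * ρ θ}, Finset.sum_pair hne, h.1, h.2]
  · norm_num
  -- The two atoms already have total mass `1`, which leaves none for a third point.
  · intro c hc
    by_contra hcS
    simp only [Finset.coe_insert, Finset.coe_singleton, Set.mem_insert_iff,
      Set.mem_singleton_iff, not_or] at hcS
    have h1 : ∑ a ∈ {c, τ 1 * ρ θ, τ (-1) * ρ θ}, μ a ≤ 1 := by
      rw [← μ.tsum_coe]; exact ENNReal.sum_le_tsum _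
    rw [Finset.sum_insert (by simp [hcS.1, hcS.2]), Finset.sum_pair hne, h.1, h.2,
      ENNReal.inv_two_add_inv_two] at h1
    have h2 : μ c ≤ 0 := (ENNReal.add_le_add_iff_right ENNReal.one_ne_top).1 (by simpa using h1)
    exact (μ.mem_support_iff c).1 hc (le_antisymm h2 zero_le)

open Classical in
theorem IsAsymmetricWreath.integral_eq {θ : ℝ} {μ : PMF (ℂ ≃ᵢ ℂ)} (h : IsAsymmetricWreath θ μ)
    {E : Type*} [NormedAddCommGroup E] [NormedSpace ℝ E] [CompleteSpace E]
    (f : (ℂ ≃ᵢ ℂ) → E) :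
    ∫ k, f k ∂μ.toMeasure = (μ (ρ θ)).toReal • f (ρ θ) + (μ (ρ (-θ))).toReal • f (ρ (-θ))
      + (μ (τ 1)).toReal • f (τ 1) + (μ (τ 1)).toReal • f (τ (-1)) := by
  have h1 : ρ θ ≠ ρ (-θ) := fun e => h.rotation_ne (congrArg μ e)
  rw [integral_toMeasure μ {ρ θ, ρ (-θ), τ 1, τ (-1)} (by rw [h.support_eq]; simp),
    Finset.sum_insert, Finset.sum_insert, Finset.sum_pair τ_one_ne_τ_neg_one,
    ← h.translation_eq]
  · simp only [add_assoc]
  · simp [ρ_ne_τ]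
  · simp [ρ_ne_τ, h1]

theorem IsAsymmetricWreath.neg {θ : ℝ} {μ : PMF (ℂ ≃ᵢ ℂ)} (h : IsAsymmetricWreath θ μ) :
    IsAsymmetricWreath (-θ) μ where
  support_eq := by rw [h.support_eq, neg_neg, Set.insert_comm]
  translation_eq := h.translation_eq
  rotation_ne := by rw [neg_neg]; exact h.rotation_ne.symm

theorem IsLittlewood.exists_weights {θ : ℝ} {μ : PMF (ℂ ≃ᵢ ℂ)} (h : IsLittlewood θ μ) :
    ∃ W : StepWeights, HasTransfer μ W (Complex.exp ((-θ : ℝ) * Complex.I)) ∧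
      stdDev μ = √(2 * W.halfVar) := by
  refine ⟨⟨0, 1, 0, 0, by norm_num, by norm_num, by norm_num, by norm_num, by norm_num,
    by norm_num, by norm_num⟩, ?_, ?_⟩
  · intro ν _ F hF ξ
    rw [h.integral_eq, integral_exp_τ_mul, integral_exp_τ_mul, integral_exp_ρ, hF, ← smul_add,
      ← add_mul, exp_inner_one_add, Complex.real_smul]
    simp only [StepWeights.transfer]
    push_cast
    ring
  · rw [stdDev, h.integral_eq]
    simp only [IsometryEquiv.mul_apply, ρ_zero, τ_zero, StepWeights.halfVar]
    norm_num

theorem IsAsymmetricWreath.exists_weights {θ : ℝ} {μ : PMF (ℂ ≃ᵢ ℂ)} (h : IsAsymmetricWreath θ μ)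
    (hlt : (μ (ρ (-θ))).toReal < (μ (ρ θ)).toReal) :
    ∃ W : StepWeights, HasTransfer μ W (Complex.exp ((-θ : ℝ) * Complex.I)) ∧
      stdDev μ = √(2 * W.halfVar) := by
  have hp : 0 < (μ (τ 1)).toReal := by
    refine ENNReal.toReal_pos ?_ (μ.apply_ne_top _)
    rw [← μ.mem_support_iff, h.support_eq]
    simp
  have hsum := h.integral_eq (fun _ => (1 : ℝ))
  simp only [integral_const, probReal_univ, smul_eq_mul, mul_one] at hsum
  refine ⟨⟨(μ (ρ θ)).toReal, 0, (μ (ρ (-θ))).toReal, 2 * (μ (τ 1)).toReal,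
    ENNReal.toReal_nonneg, le_rfl, ENNReal.toReal_nonneg, by positivity, by linarith,
    by linarith, by linarith⟩, ?_, ?_⟩
  · intro ν _ F hF ξ
    rw [h.integral_eq, integral_exp_τ, integral_exp_τ, integral_exp_ρ, integral_exp_ρ, hF, hF, hF,
      add_assoc, ← smul_add, ← add_mul, exp_inner_one_add]
    simp only [StepWeights.transfer, Complex.real_smul, conj_exp_mul_I]
    push_cast
    ring
  · rw [stdDev, h.integral_eq]
    simp only [ρ_zero, τ_zero, StepWeights.halfVar]
    congr 1
    simp only [norm_zero, norm_one, norm_neg, smul_eq_mul]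
    ring

/-- Moving a rotation across the inner product conjugates it, hence the angle `-θ`. When the drift
goes the other way, the roles of `θ` and `-θ` are exchanged; only the cosine of the angle matters
later. -/
theorem exists_weights {θ : ℝ} {μ : PMF (ℂ ≃ᵢ ℂ)} (h : IsLittlewood θ μ ∨ IsAsymmetricWreath θ μ) :
    ∃ (W : StepWeights) (φ : ℝ), Real.cos φ = Real.cos θ ∧
      HasTransfer μ W (Complex.exp (φ * Complex.I)) ∧ stdDev μ = √(2 * W.halfVar) := by
  rcases h with h | h
  · obtain ⟨W, hW⟩ := h.exists_weights
    exact ⟨W, -θ, Real.cos_neg θ, hW⟩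
  · have hne : (μ (ρ θ)).toReal ≠ (μ (ρ (-θ))).toReal := fun e => h.rotation_ne
      ((ENNReal.toReal_eq_toReal_iff' (μ.apply_ne_top _) (μ.apply_ne_top _)).1 e)
    rcases lt_or_gt_of_ne hne with hlt | hlt
    · obtain ⟨W, hW⟩ := h.neg.exists_weights (by rwa [neg_neg])
      exact ⟨W, - -θ, by rw [neg_neg], hW⟩
    · obtain ⟨W, hW⟩ := h.exists_weights hlt
      exact ⟨W, -θ, Real.cos_neg θ, hW⟩

/-! ### The local limit theorem -/

theorem exists_pow_mul_exp_neg_sqrt_le {c : ℝ} (hc : 0 < c) :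
    ∃ K : ℝ, 0 < K ∧ ∀ N : ℕ, (N : ℝ) ^ 10 * Real.exp (-c * √N) ≤ K := by
  refine ⟨(Nat.factorial 20 : ℝ) / c ^ 20, by positivity, fun N => ?_⟩
  have h1 := Real.pow_div_factorial_le_exp (x := c * √N) (by positivity) 20
  rw [div_le_iff₀ (by positivity)] at h1
  rw [le_div_iff₀ (by positivity)]
  have h2 : (N : ℝ) ^ 10 = (√N) ^ 20 := by
    rw [show 20 = 2 * 10 by norm_num, pow_mul, Real.sq_sqrt (by positivity)]
  calc (N : ℝ) ^ 10 * Real.exp (-c * √N) * c ^ 20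
      = (c * √N) ^ 20 * Real.exp (-c * √N) := by rw [h2]; ring
    _ ≤ (Real.exp (c * √N) * (Nat.factorial 20 : ℝ)) * Real.exp (-c * √N) := by gcongr
    _ = (Nat.factorial 20 : ℝ) * (Real.exp (c * √N) * Real.exp (-c * √N)) := by ring
    _ = _ := by rw [← Real.exp_add]; simp

/-- The smoothed difference between the characteristic functions of the walk and of the Gaussian is
dominated by integrable functions with small integral. -/
theorem exists_dominating {W : StepWeights} {φ : ℝ} (hrat : ∃ q : ℚ, Real.cos φ = q)
    (hhalf : ¬ ∃ k : ℤ, Real.cos φ = k / 2) :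
    ∃ A : ℝ, 0 < A ∧ ∃ c : ℝ, 0 < c ∧ ∀ N : ℕ, 0 < N → ∀ s : ℝ, 0 < s → ∀ ξ : ℂ,
      Real.exp (-(s ^ 2 / 2) * ‖ξ‖ ^ 2) * |W.char (Complex.exp (φ * Complex.I)) N ξ
          - Real.exp (-(N * W.halfVar * ‖ξ‖ ^ 2))|
        ≤ A / N * Real.exp (-(W.halfVar / 4 * N) * ‖ξ‖ ^ 2)
          + (25 + 32 / s ^ 2) * Real.exp (-c * √N) * Real.exp (-(s ^ 2 / 4) * ‖ξ‖ ^ 2) := by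
  set u := Complex.exp (φ * Complex.I) with hu
  have hunorm : ‖u‖ = 1 := Complex.norm_exp_ofReal_mul_I φ
  have hu2 : (u ^ 2).re < 1 := by
    rw [hu, pow_two, Complex.mul_re, Complex.exp_ofReal_mul_I_re, Complex.exp_ofReal_mul_I_im]
    by_contra! hcon
    have h1 := Real.sin_sq_add_cos_sq φ
    have h2 : (Real.cos φ - 1) * (Real.cos φ + 1) = 0 := by
      nlinarith [sq_nonneg (Real.sin φ)]
    rcases mul_eq_zero.1 h2 with h | h
    · exact hhalf ⟨2, by push_cast; linarith⟩
    · exact hhalf ⟨-2, by push_cast; linarith⟩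
  have hq := W.halfVar_pos
  obtain ⟨κ, hκ, A, hA, hlow⟩ := StepWeights.exists_abs_char_sub_exp_le (W := W) hunorm hu2
  obtain ⟨c, hc, hhigh⟩ := StepWeights.exists_abs_char_le hrat hhalf W hκ
  set q := W.halfVar
  -- The entry `q κ ^ 2` covers the Gaussian term at `‖ξ‖ ≥ κ`, using `√N ≤ N`.
  refine ⟨A, hA, min c (q * κ ^ 2), by positivity, fun N hN s hs ξ => ?_⟩
  have hN1 : (1 : ℝ) ≤ N := by exact_mod_cast hN
  set c₂ := min c (q * κ ^ 2) with hc₂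
  rcases le_total ‖ξ‖ κ with h | h
  · have h1 := hlow N hN ξ h
    have h2 : Real.exp (-(s ^ 2 / 2) * ‖ξ‖ ^ 2) ≤ 1 := by
      apply Real.exp_le_one_iff.2
      have : 0 ≤ s ^ 2 / 2 * ‖ξ‖ ^ 2 := by positivity
      linarith
    have h3 := mul_le_of_le_one_left (abs_nonneg (W.char u N ξ - Real.exp (-(N * q * ‖ξ‖ ^ 2)))) h2
    rw [show -(q / 4 * N * ‖ξ‖ ^ 2) = -(q / 4 * N) * ‖ξ‖ ^ 2 by ring] at h1
    have h4 : 0 ≤ (25 + 32 / s ^ 2) * Real.exp (-c₂ * √N) * Real.exp (-(s ^ 2 / 4) * ‖ξ‖ ^ 2) := by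
      positivity
    linarith
  · have hsqrt : √(N : ℝ) ≤ N := by
      rw [Real.sqrt_le_left (by positivity)]; nlinarith
    have h1 : |W.char u N ξ| ≤ 8 * (‖ξ‖ + 2) * Real.exp (-c₂ * √N) := by
      refine (hhigh N ξ h).trans ?_
      gcongr
      exact min_le_left _ _
    have h2 : Real.exp (-(N * q * ‖ξ‖ ^ 2)) ≤ Real.exp (-c₂ * √N) := by
      apply Real.exp_le_exp.2
      have e1 : c₂ * √N ≤ (q * κ ^ 2) * N := by
        gcongr; exact min_le_right _ _
      have e2 : q * N * κ ^ 2 ≤ q * N * ‖ξ‖ ^ 2 := by gcongr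
      linarith
    have h3 : |W.char u N ξ - Real.exp (-(N * q * ‖ξ‖ ^ 2))|
        ≤ (25 + 8 * ‖ξ‖ ^ 2) * Real.exp (-c₂ * √N) := by
      refine (abs_sub _ _).trans ?_
      rw [abs_of_pos (Real.exp_pos (-(N * q * ‖ξ‖ ^ 2)))]
      have e1 : 8 * (‖ξ‖ + 2) + 1 ≤ 25 + 8 * ‖ξ‖ ^ 2 := by nlinarith [sq_nonneg (‖ξ‖ - 1)]
      have e2 := mul_le_mul_of_nonneg_right e1 (Real.exp_pos (-c₂ * √N)).le
      linarith
    have h4 : Real.exp (-(s ^ 2 / 2) * ‖ξ‖ ^ 2)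
        = Real.exp (-(s ^ 2 / 4 * ‖ξ‖ ^ 2)) * Real.exp (-(s ^ 2 / 4) * ‖ξ‖ ^ 2) := by
      rw [← Real.exp_add]; congr 1; ring
    -- Half of the smoothing factor absorbs the growth in `ξ`; the other half remains for
    -- integrability.
    have h5 : (25 + 8 * ‖ξ‖ ^ 2) * Real.exp (-(s ^ 2 / 4 * ‖ξ‖ ^ 2)) ≤ 25 + 32 / s ^ 2 := by
      have e1 := mul_exp_neg_le (a := s ^ 2 / 4) (x := ‖ξ‖ ^ 2) (by positivity)
      have e2 : Real.exp (-(s ^ 2 / 4 * ‖ξ‖ ^ 2)) ≤ 1 :=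
        Real.exp_le_one_iff.2 (by have : 0 ≤ s ^ 2 / 4 * ‖ξ‖ ^ 2 := by positivity
                                  linarith)
      have e3 : 32 / s ^ 2 = 8 * (1 / (s ^ 2 / 4)) := by field_simp; norm_num
      rw [e3]
      linarith
    have h6 : 0 ≤ A / N * Real.exp (-(q / 4 * N) * ‖ξ‖ ^ 2) := by positivity
    calc _ ≤ Real.exp (-(s ^ 2 / 2) * ‖ξ‖ ^ 2) * ((25 + 8 * ‖ξ‖ ^ 2) * Real.exp (-c₂ * √N)) := by
          gcongr
      _ = ((25 + 8 * ‖ξ‖ ^ 2) * Real.exp (-(s ^ 2 / 4 * ‖ξ‖ ^ 2))) * Real.exp (-c₂ * √N)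
          * Real.exp (-(s ^ 2 / 4) * ‖ξ‖ ^ 2) := by rw [h4]; ring
      _ ≤ (25 + 32 / s ^ 2) * Real.exp (-c₂ * √N) * Real.exp (-(s ^ 2 / 4) * ‖ξ‖ ^ 2) := by
          gcongr
      _ ≤ _ := by linarith

/-- Local limit theorem for measures with the characteristic functions of the walk. -/
theorem exists_local_limit {W : StepWeights} {φ : ℝ} (hrat : ∃ q : ℚ, Real.cos φ = q)
    (hhalf : ¬ ∃ k : ℤ, Real.cos φ = k / 2) :
    ∃ c : ℝ, 0 < c ∧ ∃ C : ℝ, 0 < C ∧ ∀ N : ℕ, 2 ≤ N → ∀ (ν : Measure ℂ) [IsProbabilityMeasure ν],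
      (∀ ξ, charFun ν ξ = W.char (Complex.exp (φ * Complex.I)) N ξ) →
      ∀ (x : ℂ) (r : ℝ), Real.exp (-c * √N) < r →
        |ν.real (Metric.ball x r) - (planarGaussian (√(2 * W.halfVar) * √N)).real (Metric.ball x r)|
          ≤ C * r ^ 2 / (N : ℝ) ^ 2 := by
  obtain ⟨A, hA, c, hc, hdom⟩ := exists_dominating (W := W) hrat hhalf
  obtain ⟨K, hK, hKN⟩ := exists_pow_mul_exp_neg_sqrt_le (half_pos hc)
  have hpi := Real.pi_pos
  have hq := W.halfVar_pos
  set q := W.halfVar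
  set m₀ := 1 / (4 * Real.pi * q) with hm₀
  set D₀ := 4 * Real.pi * A / q + 57 * 256 * 4 * Real.pi * K with hD₀
  have hm₀0 : 0 < m₀ := by positivity
  have hD₀0 : 0 < D₀ := by positivity
  -- The high-frequency integral costs `s ^ (-4)`, of order `N ^ 8 r ^ (-4)`. With `r > exp (-(c /
  -- 8) √N)` this uses up only half of `exp (-c √N)`, and the rest beats `N ^ 10`.
  refine ⟨c / 8, by positivity, Real.pi * (14 * m₀ + 6 * D₀), by positivity,
    fun N hN ν _ hν x r hr => ?_⟩
  have hN2 : (2 : ℝ) ≤ N := by exact_mod_cast hN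
  have hN0 : (0 : ℝ) < N := by linarith
  have hr0 : 0 < r := (Real.exp_pos _).trans hr
  set S := √(2 * q) * √N with hS
  have hS0 : 0 < S := by positivity
  have hS2 : S ^ 2 = 2 * q * N := by
    rw [hS, mul_pow, Real.sq_sqrt (by positivity), Real.sq_sqrt (by positivity)]
  -- With `δ = 1 / N` this width gives the tail `η = 1 / (2 N ^ 2)`. The limiting density is of
  -- order `1 / N`, so the boundary loss `δ M` is of order `N ^ (-2)`.
  set s := r / (4 * N ^ 2) with hs
  have hs0 : 0 < s := by positivity
  have := isProbabilityMeasure_planarGaussian hS0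
  have := isProbabilityMeasure_planarGaussian hs0
  set G : ℂ → ℝ := fun ξ => A / N * Real.exp (-(q / 4 * N) * ‖ξ‖ ^ 2)
    + (25 + 32 / s ^ 2) * Real.exp (-c * √N) * Real.exp (-(s ^ 2 / 4) * ‖ξ‖ ^ 2) with hG
  have i1 := (integrable_exp_neg_mul_sq_norm (b := q / 4 * N) (by positivity)).const_mul (A / N)
  have i2 := (integrable_exp_neg_mul_sq_norm (b := s ^ 2 / 4) (by positivity)).const_mul
    ((25 + 32 / s ^ 2) * Real.exp (-c * √N))
  have hGint : Integrable G := i1.add i2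
  have hcf : ∀ ξ, Real.exp (-(s ^ 2 / 2) * ‖ξ‖ ^ 2)
      * ‖charFun ν ξ - charFun (planarGaussian S) ξ‖ ≤ G ξ := fun ξ => by
    refine le_trans (le_of_eq ?_) (hdom N (by omega) s hs0 ξ)
    rw [hν, charFun_planarGaussian hS0, ← Complex.ofReal_neg, ← Complex.ofReal_exp, ← Complex.ofReal_sub,
      Complex.norm_real, Real.norm_eq_abs, hS2]
    congr 4
    ring_nf
  have hcf' : ∀ ξ, Real.exp (-(s ^ 2 / 2) * ‖ξ‖ ^ 2)
      * ‖charFun (planarGaussian S) ξ - charFun ν ξ‖ ≤ G ξ := fun ξ => by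
    rw [norm_sub_rev]; exact hcf ξ
  have hGD : ∫ ξ, G ξ ≤ D₀ / N ^ 2 := by
    rw [hG, integral_add i1 i2, integral_const_mul, integral_const_mul,
      integral_exp_neg_mul_sq_norm (by positivity), integral_exp_neg_mul_sq_norm (by positivity)]
    have hinv : 1 / s ^ 2 ≤ 16 * N ^ 4 * Real.exp (c / 4 * √N) := by
      have e1 : 1 / r ≤ Real.exp (c / 8 * √N) := by
        rw [div_le_iff₀ hr0]
        calc (1 : ℝ) = Real.exp (c / 8 * √N) * Real.exp (-(c / 8) * √N) := by
              rw [← Real.exp_add]; simp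
          _ ≤ _ := by gcongr
      calc 1 / s ^ 2 = 16 * N ^ 4 * (1 / r) ^ 2 := by rw [hs]; field_simp; norm_num
        _ ≤ 16 * N ^ 4 * (Real.exp (c / 8 * √N)) ^ 2 := by gcongr
        _ = _ := by rw [← Real.exp_nat_mul]; congr 2; push_cast; ring
    set Q := 16 * (N : ℝ) ^ 4 * Real.exp (c / 4 * √N) with hQ
    have hQ1 : 1 ≤ Q := by
      have e1 : 1 ≤ (N : ℝ) ^ 4 := one_le_pow₀ (by linarith)
      have e2 : 1 ≤ Real.exp (c / 4 * √N) := Real.one_le_exp (by positivity)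
      rw [hQ]; nlinarith
    have e1 : (25 + 32 / s ^ 2) ≤ 57 * Q := by
      rw [show 32 / s ^ 2 = 32 * (1 / s ^ 2) by ring]; linarith
    have e2 : Real.pi / (s ^ 2 / 4) ≤ 4 * Real.pi * Q := by
      rw [show Real.pi / (s ^ 2 / 4) = 4 * Real.pi * (1 / s ^ 2) by field_simp]; gcongr
    have e3 : Q ^ 2 * Real.exp (-c * √N) = 256 * (N : ℝ) ^ 8 * Real.exp (-(c / 2) * √N) := by
      have : Real.exp (-(c / 2) * √N) = Real.exp (c / 4 * √N) ^ 2 * Real.exp (-c * √N) := by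
        rw [← Real.exp_nat_mul, ← Real.exp_add]; congr 1; push_cast; ring
      rw [this, hQ]; ring
    have e4 : (N : ℝ) ^ 8 * Real.exp (-(c / 2) * √N) ≤ K / N ^ 2 := by
      rw [le_div_iff₀ (by positivity)]
      calc _ = (N : ℝ) ^ 10 * Real.exp (-(c / 2) * √N) := by ring
        _ ≤ K := hKN N
    calc _ ≤ A / N * (Real.pi / (q / 4 * N))
          + 57 * Q * Real.exp (-c * √N) * (4 * Real.pi * Q) := by gcongr
      _ = A / N * (Real.pi / (q / 4 * N)) + 57 * 4 * Real.pi * (Q ^ 2 * Real.exp (-c * √N)) := by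
          ring
      _ = A / N * (Real.pi / (q / 4 * N))
          + 57 * 4 * Real.pi * 256 * ((N : ℝ) ^ 8 * Real.exp (-(c / 2) * √N)) := by rw [e3]; ring
      _ ≤ A / N * (Real.pi / (q / 4 * N)) + 57 * 4 * Real.pi * 256 * (K / N ^ 2) := by gcongr
      _ = _ := by rw [hD₀]; field_simp
  set D := D₀ / (N : ℝ) ^ 2 with hD
  have hD0 : 0 ≤ D := by positivity
  have hball : ∀ (x : ℂ) (R : ℝ), 0 ≤ R → ∀ (ν₁ ν₂ : Measure ℂ) [IsProbabilityMeasure ν₁]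
      [IsProbabilityMeasure ν₂], (∀ ξ, Real.exp (-(s ^ 2 / 2) * ‖ξ‖ ^ 2)
        * ‖charFun ν₁ ξ - charFun ν₂ ξ‖ ≤ G ξ) →
      (ν₁ ∗ planarGaussian s).real (Metric.ball x R)
        ≤ (ν₂ ∗ planarGaussian s).real (Metric.ball x R) + D * (Real.pi * R ^ 2) := by
    intro x R hR ν₁ ν₂ _ _ h
    have h1 := conv_planarGaussian_le hD0 ν₁ ν₂ (fun y =>
      (abs_integral_gaussianKernel_sub_le hs0 ν₁ ν₂ hGint h y).trans hGD)
      (Metric.isOpen_ball (x := x) (ε := R)).measurableSet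
    rw [volume_ball_eq x hR, ← ENNReal.ofReal_mul hD0] at h1
    have h2 := ENNReal.toReal_mono
      (ENNReal.add_ne_top.2 ⟨measure_ne_top _ _, ENNReal.ofReal_ne_top⟩) h1
    rwa [ENNReal.toReal_add (measure_ne_top _ _) ENNReal.ofReal_ne_top,
      ENNReal.toReal_ofReal (by positivity)] at h2
  have htail : (planarGaussian s).real {u | 1 / N * r ≤ ‖u‖} ≤ 1 / (2 * N ^ 2) := by
    refine (planarGaussian_tail_le hs0 (by positivity)).trans (le_of_eq ?_)
    rw [hs]; field_simp; norm_num
  have hN2sq : (4 : ℝ) ≤ (N : ℝ) ^ 2 := by nlinarith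
  have key := abs_ball_sub_ball_le (ν₁ := ν) (ν₂ := planarGaussian S) (γ := planarGaussian s)
    (M := (2 * Real.pi * S ^ 2)⁻¹) (D := D) (δ := 1 / N) (η := 1 / (2 * N ^ 2)) (r := r)
    (by positivity) hD0 hr0 (by positivity) (one_div_le_one_div_of_le (by norm_num) hN2)
    (one_div_le_one_div_of_le (by norm_num) (by linarith)) htail
    (fun S hS => planarGaussian_le_volume hS)
    (fun y R hR => hball y R hR ν (planarGaussian S) hcf)
    (fun y R hR => hball y R hR (planarGaussian S) ν hcf') x
  refine key.trans ?_
  have hM : (2 * Real.pi * S ^ 2)⁻¹ = m₀ / N := by rw [hS2, hm₀]; field_simp; norm_num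
  rw [hM]
  have f1 : 15 * (1 / (2 * (N : ℝ) ^ 2)) * (m₀ / N) ≤ 8 * m₀ / N ^ 2 := by
    have : m₀ / N ≤ m₀ := div_le_self hm₀0.le (by linarith)
    calc _ ≤ 15 * (1 / (2 * (N : ℝ) ^ 2)) * m₀ := by gcongr
      _ = 15 / 2 * m₀ / N ^ 2 := by field_simp
      _ ≤ _ := by gcongr; norm_num
  have f2 : 6 * (1 / (N : ℝ)) * (m₀ / N) = 6 * m₀ / N ^ 2 := by field_simp
  calc _ ≤ Real.pi * r ^ 2 * (8 * m₀ / N ^ 2 + 6 * m₀ / N ^ 2 + 6 * D) := by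
        gcongr; exact f2.le
    _ = _ := by rw [hD]; field_simp; ring

end PlanarWalk

open PlanarWalk in
theorem theorem3 (θ : ℝ) (μ : PMF (ℂ ≃ᵢ ℂ))
    (hμ : IsLittlewood θ μ ∨ IsAsymmetricWreath θ μ)
    (hrat : ∃ q : ℚ, Real.cos θ = q)
    (hhalf : ¬ ∃ k : ℤ, Real.cos θ = k / 2) :
    ∃ c : ℝ, 0 < c ∧ ∃ C : ℝ, 0 < C ∧
      ∀ {Ω : Type*} [MeasurableSpace Ω] (P : Measure Ω) [IsProbabilityMeasure P]
        (g : ℕ → Ω → (ℂ ≃ᵢ ℂ)), IsIIDSample P g μ →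
      ∀ N : ℕ, 2 ≤ N → ∀ (x₀ : ℂ) (r : ℝ), Real.exp (-c * √N / Real.log N) < r →
        |P.real {ω | walk g N ω ∈ Metric.ball x₀ r}
            - (stdGaussian ℂ).real {z : ℂ | (stdDev μ * √N) • z ∈ Metric.ball x₀ r}|
          ≤ C * (N : ℝ) ^ (-(3 / 2) : ℝ) * r ^ 2 := by
  obtain ⟨W, φ, hφ, hW, hσ⟩ := exists_weights hμ
  rw [← hφ] at hrat hhalf
  obtain ⟨c, hc, C, hC, hlim⟩ := exists_local_limit (W := W) hrat hhalf
  have hq := W.halfVar_pos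
  have hl2 : 0 < Real.log 2 := Real.log_pos (by norm_num)
  -- As `log N ≥ log 2`, the factor `log 2` puts every admissible `r` in the wider range `r > exp
  -- (-c √N)`.
  refine ⟨c * Real.log 2, by positivity, C, hC, fun P _ g hg N hN x₀ r hr => ?_⟩
  have hN2 : (2 : ℝ) ≤ N := by exact_mod_cast hN
  have hN0 : (0 : ℝ) < N := by linarith
  have hwalk := aemeasurable_walk hg.aemeasurable N
  have hprob : IsProbabilityMeasure (P.map (walk g N)) := Measure.isProbabilityMeasure_map hwalk
  have hB : MeasurableSet (Metric.ball x₀ r) := Metric.isOpen_ball.measurableSet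
  have hr' : Real.exp (-c * √N) < r := by
    refine lt_of_le_of_lt (Real.exp_le_exp.2 ?_) hr
    have hlog : Real.log 2 ≤ Real.log N := Real.log_le_log (by norm_num) hN2
    rw [le_div_iff₀ (hl2.trans_le hlog)]
    have : c * √N * Real.log 2 ≤ c * √N * Real.log N := by gcongr
    linarith
  have hS0 : 0 < √(2 * W.halfVar) * √N := by positivity
  have h := hlim N hN (P.map (walk g N)) (hg.charFun_map_walk hW N) x₀ r hr'
  have h1 : (P.map (walk g N)).real (Metric.ball x₀ r)
      = P.real {ω | walk g N ω ∈ Metric.ball x₀ r} := by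
    rw [measureReal_def, Measure.map_apply_of_aemeasurable hwalk hB]; rfl
  have h2 : (planarGaussian (√(2 * W.halfVar) * √N)).real (Metric.ball x₀ r)
      = (stdGaussian ℂ).real {z : ℂ | (stdDev μ * √N) • z ∈ Metric.ball x₀ r} := by
    rw [← map_smul_stdGaussian hS0, map_measureReal_apply (by fun_prop) hB, hσ]; rfl
  rw [h1, h2] at h
  refine h.trans ?_
  have h3 : ((N : ℝ) ^ 2)⁻¹ ≤ (N : ℝ) ^ (-(3 / 2) : ℝ) := by
    rw [← Real.rpow_natCast, ← Real.rpow_neg hN0.le]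
    exact Real.rpow_le_rpow_of_exponent_le (by linarith) (by norm_num)
  rw [mul_right_comm, div_eq_mul_inv]
  gcongr
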